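/- **Theorem (convergence of ZO-AdaExpGrad+).** Let $d\ge 2$, let $\mathcal K\subseteq\mathbb R^d$ be closed and convex, $r:\mathbb R^d\to\mathbb R$ convex, $\xi$ a random variable with law $\mathcal D$, and $l(x)=\mathbb E_\xi[l(x;\xi)]$, $f=l+r$. Here $l(x;\cdot)$ is measurable and integrable for each $x\in\mathbb R^d$. Assume: 1. for every realisation $\xi$, $l(\cdot;\xi)$ is differentiable on $\mathbb R^d$, $G$-Lipschitz, and $\nabla l(\cdot;\xi)$ is $L$-Lipschitz, all with respect to $\|\cdot\|_2$; 2. $\mathbb E_\xi[\nabla l(x;\xi)]=\nabla l(x)$ for all $x\in\mathbb R^d$, and $\mathbb E_\xi\|\nabla l(x)-\nabla l(x;\xi)\|_2^2\le\sigma^2$ for all $x\in\mathcal K$; 3. $f(x)\in[0,R]$ for all $x\in\mathcal K$, for some $R>0$. Let $\phi(x)=\sum_{i=1}^d\big((|x_i|+\tfrac1d)\ln(d|x_i|+1)-|x_i|\big)$. For a differentiable $\psi$ let $\mathcal B_\psi(y,x)=\psi(y)-\psi(x)-\langle\nabla\psi(x),y-x\rangle$, $$\mathcal P^\psi_{\mathcal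 K}(x,g,\eta)=\operatorname*{arg\,min}_{y\in\mathcal K}\ \langle g,y\rangle+r(y)+\eta\,\mathcal B_\psi(y,x),\qquad \mathcal G^\psi_{\mathcal K}(x,g,\eta)=\eta\,\big(x-\mathcal P^\psi_{\mathcal K}(x,g,\eta)\big).$$ Assume further that 4. for some $D>0$, $\|\mathcal P^\phi_{\mathcal K}(x,g,\eta)\|_1\le D$ for all $x\in\mathcal K$, $g\in\mathbb R^d$, $\eta>0$. Let $T\ge1$, $m=2Te(2\ln d-1)$, let the mini-batch size $N$ be any integer with $N\ge m$ (e.g. $N=\lceil m\rceil$), let $\nu=\frac1{d\sqrt T}$ and $x_1\in\mathcal K$. For $t=1,\dots,T$ put $$g_t=\frac1{N\nu}\sum_{j=1}^N\big(l(x_t+\nu u_{t,j};\xi_{t,j})-l(x_t;\xi_{t,j})\big)u_{t,j},\qquad v_t=\mathcal P^\phi_{\mathcal K}(x_t,g_t,\alpha_t),\qquad x_{t+1}=\Big(1-\frac{\alpha_t}{\alpha_{t+1}}\Big)x_t+\frac{\alpha_t}{\alpha_{t+1}}v_t,$$ $$\lambda_t=\frac1{\max\{\|x_t\|_1,\|v_t\|_1\}+1},\qquad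 \alpha_t=\sqrt{\max\Big\{\sum_{s=1}^{t-1}\lambda_s^2\alpha_s^2\|v_s-x_s\|_1^2,\,1\Big\}},$$ where the pairs $(\xi_{t,j},u_{t,j})$ are i.i.d., $\xi_{t,j}\sim\mathcal D$, and $u_{t,j}$ is independent of $\xi_{t,j}$ and has independent Rademacher coordinates (uniform on $\{-1,1\}$). Let $\tau$ be uniform on $\{1,\dots,T\}$ and independent of all the samples. Put $\psi=(D+1)\phi$ and $\eta_t=\frac{\alpha_t}{D+1}$, so that $v_t=\mathcal P^{\psi}_{\mathcal K}(x_t,g_t,\eta_t)$ as well. Then $\|\mathcal G^{\psi}_{\mathcal K}(x_\tau,\nabla l(x_\tau),\eta_\tau)\|_1^2$ is integrable and $$\mathbb E\big\|\mathcal G^{\psi}_{\mathcal K}(x_\tau,\nabla l(x_\tau),\eta_\tau)\big\|_1^2\ \le\ \sqrt{\frac{2e(2\ln d-1)}{mT}}\,(10V+C),$$ where $V=10G^2+8\sigma^2+2L^2$ and $C=8R^2+8R+16L^2(D+1)^2$. -/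

import Mathlib

open MeasureTheory ProbabilityTheory

/-- The decision space `ℝ^d`; its norm is the Euclidean norm. -/
abbrev Vec (d : ℕ) : Type := EuclideanSpace ℝ (Fin d)

/-- The norm `‖x‖₁ = ∑ i, |x i|`. -/
def l1Norm {d : ℕ} (x : Vec d) : ℝ := ∑ i, |x i|

section Mirror

variable {d : ℕ}

/-- The symmetric entropy
`φ(x) = ∑ i, ((|x i| + 1/d) ln (d |x i| + 1) - |x i|)`. -/
noncomputable def symEntropy (x : Vec d) : ℝ :=
  ∑ i, ((|x i| + 1 / (d : ℝ)) * Real.log ((d : ℝ) * |x i| + 1) - |x i|)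

/-- The Bregman divergence `B_ψ(y, x) = ψ(y) - ψ(x) - ⟨∇ψ(x), y - x⟩`. -/
noncomputable def bregman (ψ : Vec d → ℝ) (y x : Vec d) : ℝ :=
  ψ y - ψ x - inner ℝ (gradient ψ x) (y - x)

/-- `p` is a minimiser over `K` of `y ↦ ⟨g, y⟩ + r(y) + η B_ψ(y, x)`. -/
def IsMirrorProx (K : Set (Vec d)) (r ψ : Vec d → ℝ) (x g : Vec d) (η : ℝ) (p : Vec d) : Prop :=
  p ∈ K ∧ IsMinOn (fun y => inner ℝ g y + r y + η * bregman ψ y x) K p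

/-- The generalised projection `P_K(x, g, η) = argmin_{y ∈ K} ⟨g, y⟩ + r(y) + η B_ψ(y, x)`
with distance-generating function `ψ`. (The minimiser exists and is unique when `K` is closed,
convex and nonempty, `r` is convex, `η > 0`, and `ψ` is a positive multiple of `symEntropy`.) -/
noncomputable def mirrorProx (K : Set (Vec d)) (r ψ : Vec d → ℝ) (x g : Vec d) (η : ℝ) : Vec d :=
  Classical.epsilon (IsMirrorProx K r ψ x g η)

/-- The generalised gradient map `G_K(x, g, η) = η (x - P_K(x, g, η))`
with distance-generating function `ψ`. -/
noncomputable def gradMap (K : Set (Vec d)) (r ψ : Vec d → ℝ) (x g : Vec d) (η : ℝ) : Vec d :=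
  η • (x - mirrorProx K r ψ x g η)

end Mirror

section Loss

variable {d : ℕ} {Ξ : Type*} [MeasurableSpace Ξ]

/-- The expected loss `l(x) = E_ξ[l(x; ξ)]`, where `ξ` has law `𝒟`. -/
noncomputable def expLoss (𝒟 : Measure Ξ) (l : Vec d → Ξ → ℝ) (x : Vec d) : ℝ :=
  ∫ ξ, l x ξ ∂𝒟

/-- Every `l(·; ξ)` is differentiable, is `G`-Lipschitz and has an `L`-Lipschitz gradient, with
respect to the Euclidean norm. -/
structure IsSmoothLoss (l : Vec d → Ξ → ℝ) (G L : ℝ) : Prop where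
  differentiable : ∀ ξ, Differentiable ℝ (fun x => l x ξ)
  lipschitz : ∀ ξ x y, |l x ξ - l y ξ| ≤ G * ‖x - y‖
  lipschitz_gradient : ∀ ξ x y,
    ‖gradient (fun z => l z ξ) x - gradient (fun z => l z ξ) y‖ ≤ L * ‖x - y‖

/-- The loss is measurable and integrable in `ξ`, and the stochastic gradient is unbiased:
`E_ξ[∇l(x; ξ)] = ∇l(x)`. -/
structure IsUnbiasedLoss (𝒟 : Measure Ξ) (l : Vec d → Ξ → ℝ) : Prop where
  measurable : ∀ x, Measurable (l x)
  integrable : ∀ x, Integrable (l x) 𝒟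
  unbiased : ∀ x, ∫ ξ, gradient (fun z => l z ξ) x ∂𝒟 = gradient (expLoss 𝒟 l) x

end Loss

section Sampling

/-- The Rademacher distribution on `ℝ`: the values `1` and `-1` with probability `1/2` each. -/
noncomputable def rademacher : Measure ℝ :=
  (2⁻¹ : ENNReal) • Measure.dirac 1 + (2⁻¹ : ENNReal) • Measure.dirac (-1)

/-- The law on `ℝ^d` of a vector with independent Rademacher coordinates. -/
noncomputable def rademacherVec (d : ℕ) : Measure (Vec d) :=
  (Measure.pi (fun _ : Fin d => rademacher)).map (WithLp.toLp 2)

/-- The randomness of the algorithm: the pairs `(ξ t j, u t j)` are independent and identically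
distributed, `ξ t j` has law `𝒟`, `u t j` has independent Rademacher coordinates and is
independent of `ξ t j`; the index `τ` is uniform on `{1, …, T}` and independent of all samples.
(`t` is the iteration, `j` the position in the mini-batch of size `N`.) -/
structure IsSampling {d : ℕ} {Ξ Ω : Type*} [MeasurableSpace Ξ] [MeasurableSpace Ω]
    (P : Measure Ω) (𝒟 : Measure Ξ) (T N : ℕ)
    (ξ : ℕ → Fin N → Ω → Ξ) (u : ℕ → Fin N → Ω → Vec d) (τ : Ω → ℕ) : Prop where
  measurable_xi : ∀ t j, Measurable (ξ t j)
  measurable_u : ∀ t j, Measurable (u t j)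
  measurable_tau : Measurable τ
  law : ∀ t j, P.map (fun ω => (ξ t j ω, u t j ω)) = 𝒟.prod (rademacherVec d)
  indep : iIndepFun (fun (p : ℕ × Fin N) ω => (ξ p.1 p.2 ω, u p.1 p.2 ω)) P
  law_tau : P.map τ = uniformOn (Set.Icc 1 T)
  indep_tau : IndepFun τ (fun ω (p : ℕ × Fin N) => (ξ p.1 p.2 ω, u p.1 p.2 ω)) P

end Sampling

section Algorithm

variable {d : ℕ} {Ξ : Type*}

/-- The mini-batch two-point gradient estimate
`(1 / (N ν)) ∑ j, (l(x + ν u j; ξ j) - l(x; ξ j)) u j`. -/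
noncomputable def twoPointEstimate {N : ℕ} (l : Vec d → Ξ → ℝ) (ν : ℝ) (x : Vec d)
    (ξ : Fin N → Ξ) (u : Fin N → Vec d) : Vec d :=
  (1 / ((N : ℝ) * ν)) • ∑ j, (l (x + ν • u j) (ξ j) - l x (ξ j)) • u j

/-- `T` iterations of ZO-AdaExpGrad+ from the point `x₁`, on the samples `ξ t j`, `u t j` for
`1 ≤ t ≤ T`: the iterates `x t`, the gradient estimates `g t`, the mirror steps `v t`, and the
adaptive parameters `lam t` and `α t`. -/
structure IsZOAdaExpGradPlusRun {N : ℕ} (K : Set (Vec d)) (r : Vec d → ℝ)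
    (l : Vec d → Ξ → ℝ) (ν : ℝ) (T : ℕ) (x₁ : Vec d)
    (ξ : ℕ → Fin N → Ξ) (u : ℕ → Fin N → Vec d)
    (x g v : ℕ → Vec d) (lam α : ℕ → ℝ) : Prop where
  init : x 1 = x₁
  estimate : ∀ t ∈ Finset.Icc 1 T, g t = twoPointEstimate l ν (x t) (ξ t) (u t)
  mirror_step : ∀ t ∈ Finset.Icc 1 T, v t = mirrorProx K r symEntropy (x t) (g t) (α t)
  lam_eq : ∀ t ∈ Finset.Icc 1 T, lam t = 1 / (max (l1Norm (x t)) (l1Norm (v t)) + 1)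
  alpha_eq : ∀ t ∈ Finset.Icc 1 (T + 1),
    α t = √(max (∑ s ∈ Finset.Ico 1 t, lam s ^ 2 * α s ^ 2 * l1Norm (v s - x s) ^ 2) 1)
  update : ∀ t ∈ Finset.Icc 1 T,
    x (t + 1) = (1 - α t / α (t + 1)) • x t + (α t / α (t + 1)) • v t

end Algorithm

/-! For the prescribed `m` the square root on the right equals `1/T`, and averaging over the uniform
`τ` turns the left side into `1/T` times the sum over `t` of the mean squared gradient maps. So that
sum has to be bounded by a constant that does not depend on `T`.

Geometry. The Hessian of `symEntropy` is diagonal with entries `1/(|x i| + 1/d)`, so by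
Cauchy-Schwarz the entropy is strongly convex for `l1Norm` with modulus `1/(M+1)` on the `ℓ₁`-ball
of radius `M`. The bound `D` on the outputs of the mirror step bounds all of `K`: with zero gradient
and large `η` the step from `x` ends arbitrarily close to `x` (`l1Norm_le_of_mirrorProx_le`). Hence
`K` is compact, minimisers exist, and the mirror step scaled by `η/(D+1)` is 1-Lipschitz in the
gradient, from `supNorm` to `l1Norm`.

Pathwise part. Smoothness, convexity of `r` and descent of the mirror step bound the decrease of the
objective. Weighting this by `α (t+1)`, telescoping, and using that the weights are controlled by
the normalised steps themselves gives a quadratic inequality for the root of the sum of squared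
steps (`sum_sq_le_of_adaptive`). Passing from estimated to true gradients costs the estimation error
once more (`IsZOAdaExpGradPlusRun.sum_sq_gradMap_le`).

Noise. A two-point estimate equals `⟨∇l(x;ξ), u⟩ u` up to a bias of order `Lνd`. For a Rademacher
`u` this vector has mean `∇l(x)`, and its squared sup norm has mean at most `G²`, with no factor
`d`. Averaging a batch gains `1/N` up to a factor `ln d`, because the sup norm is comparable to the
`2`-smooth `ℓ_{2k}` norm with `k` about `ln d`. Since `N ≥ m`, each squared error has mean `O(1/T)`,
so the `T` errors sum to a constant. This is applied at the random iterate `x t`, which depends only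
on earlier batches. -/

/-- One summand of the symmetric entropy. -/
noncomputable def entropyTerm (c z : ℝ) : ℝ :=
  (|z| + 1 / c) * Real.log (c * |z| + 1) - |z|

/-- The derivative of `entropyTerm`. -/
noncomputable def entropyTermDeriv (c z : ℝ) : ℝ :=
  (SignType.sign z : ℝ) * Real.log (c * |z| + 1)

/-! ### Calculus of one summand of the entropy. -/

section OneDim

variable {c : ℝ}

theorem continuous_entropyTerm (hc : 0 < c) : Continuous (entropyTerm c) := by
  unfold entropyTerm
  refine ((continuous_abs.add continuous_const).mul (Continuous.log (by fun_prop) ?_)).sub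
    continuous_abs
  intro z
  positivity

theorem abs_entropyTermDeriv (hc : 0 < c) (z : ℝ) :
    |entropyTermDeriv c z| = Real.log (c * |z| + 1) := by
  have h : 0 ≤ Real.log (c * |z| + 1) := Real.log_nonneg (by nlinarith [mul_nonneg hc.le (abs_nonneg z)])
  rcases lt_trichotomy z 0 with hz | rfl | hz
  · simp [entropyTermDeriv, sign_neg hz, -abs_neg]
    simpa using h
  · simp [entropyTermDeriv]
  · simp [entropyTermDeriv, sign_pos hz, abs_of_nonneg h]

theorem continuous_entropyTermDeriv (hc : 0 < c) : Continuous (entropyTermDeriv c) := by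
  have hlog : Continuous fun z : ℝ => Real.log (c * |z| + 1) :=
    Continuous.log (by fun_prop) fun z => by positivity
  rw [continuous_iff_continuousAt]
  intro z
  rcases eq_or_ne z 0 with rfl | hz
  · have h0 : entropyTermDeriv c 0 = 0 := by simp [entropyTermDeriv]
    rw [ContinuousAt, h0]
    refine squeeze_zero_norm (fun z => (abs_entropyTermDeriv hc z).le) ?_
    have := hlog.tendsto 0
    simpa using this
  · refine ContinuousAt.mul ?_ hlog.continuousAt
    rcases lt_or_gt_of_ne hz with h | h
    · refine (continuousAt_const (y := (-1 : ℝ))).congr ?_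
      filter_upwards [gt_mem_nhds h] with y hy
      simp [sign_neg hy]
    · refine (continuousAt_const (y := (1 : ℝ))).congr ?_
      filter_upwards [lt_mem_nhds h] with y hy
      simp [sign_pos hy]

/-- Only `z = 0` is delicate, since `|z|` has a kink there. The candidate derivative is continuous
at `0`, so the formula extends from the punctured line. -/
theorem hasDerivAt_entropyTerm (hc : 0 < c) (z : ℝ) :
    HasDerivAt (entropyTerm c) (entropyTermDeriv c z) z := by
  have key : ∀ y : ℝ, y ≠ 0 → HasDerivAt (entropyTerm c) (entropyTermDeriv c y) y := by
    intro y hy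
    have ha := hasDerivAt_abs hy
    have hpos : c * |y| + 1 ≠ 0 := by positivity
    have := ((ha.add_const (1 / c)).mul (((ha.const_mul c).add_const 1).log hpos)).sub ha
    refine this.congr_deriv ?_
    unfold entropyTermDeriv
    field_simp
    ring
  rcases eq_or_ne z 0 with rfl | hz
  · exact hasDerivAt_of_hasDerivAt_of_ne key (continuous_entropyTerm hc).continuousAt
      (continuous_entropyTermDeriv hc).continuousAt
  · exact key z hz

theorem hasDerivAt_entropyTermDeriv (hc : 0 < c) (z : ℝ) :
    HasDerivAt (entropyTermDeriv c) (1 / (|z| + 1 / c)) z := by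
  have key : ∀ y : ℝ, y ≠ 0 → HasDerivAt (entropyTermDeriv c) (1 / (|y| + 1 / c)) y := by
    intro y hy
    have ha := hasDerivAt_abs hy
    have hpos : c * |y| + 1 ≠ 0 := by positivity
    have hl := ((ha.const_mul c).add_const 1).log hpos
    rcases lt_or_gt_of_ne hy with h | h
    · have h1 := (hl.const_mul (-1))
      refine (h1.congr_of_eventuallyEq ?_).congr_deriv ?_
      · filter_upwards [gt_mem_nhds h] with w hw
        simp [entropyTermDeriv, sign_neg hw]
      · simp only [sign_neg h]
        field_simp
        simp
    · have h1 := (hl.const_mul 1)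
      refine (h1.congr_of_eventuallyEq ?_).congr_deriv ?_
      · filter_upwards [lt_mem_nhds h] with w hw
        simp [entropyTermDeriv, sign_pos hw]
      · simp only [sign_pos h]
        field_simp
        simp
  rcases eq_or_ne z 0 with rfl | hz
  · refine hasDerivAt_of_hasDerivAt_of_ne (g := fun z => 1 / (|z| + 1 / c)) key
      (continuous_entropyTermDeriv hc).continuousAt ?_
    refine ContinuousAt.div continuousAt_const (by fun_prop) ?_
    positivity
  · exact key z hz

end OneDim

/-! ### Strong convexity of the symmetric entropy in `ℓ₁`, and the dual pair of `ℓ₁` and sup norms.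
-/

section SymEntropy

variable {d : ℕ}

/-- The gradient of the symmetric entropy. -/
noncomputable def symGrad (x : Vec d) : Vec d :=
  WithLp.toLp 2 fun i => entropyTermDeriv d (x i)

theorem continuous_symEntropy (hd : 0 < d) : Continuous (symEntropy : Vec d → ℝ) := by
  have hc : (0 : ℝ) < d := by exact_mod_cast hd
  have h := continuous_entropyTerm hc
  have : (symEntropy : Vec d → ℝ) = fun x => ∑ i, entropyTerm d (x i) := rfl
  rw [this]
  fun_prop

theorem continuous_symGrad (hd : 0 < d) : Continuous (symGrad : Vec d → Vec d) := by
  have hc : (0 : ℝ) < d := by exact_mod_cast hd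
  have h := continuous_entropyTermDeriv hc
  unfold symGrad
  fun_prop

theorem inner_vec (a b : Vec d) : inner ℝ a b = ∑ i, a i * b i := by
  simp [PiLp.inner_apply, mul_comm]

theorem hasGradientAt_symEntropy (hd : 0 < d) (x : Vec d) :
    HasGradientAt symEntropy (symGrad x) x := by
  have hc : (0 : ℝ) < d := by exact_mod_cast hd
  rw [hasGradientAt_iff_hasFDerivAt]
  have h : ∀ i ∈ (Finset.univ : Finset (Fin d)), HasFDerivAt (fun x : Vec d => entropyTerm d (x i))
      (entropyTermDeriv d (x i) • (EuclideanSpace.proj i : Vec d →L[ℝ] ℝ)) x := by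
    intro i _
    exact (hasDerivAt_entropyTerm hc (x i)).comp_hasFDerivAt x
      (EuclideanSpace.proj i : Vec d →L[ℝ] ℝ).hasFDerivAt
  refine (HasFDerivAt.fun_sum h).congr_fderiv ?_
  ext y
  simp [inner_vec, symGrad]

theorem gradient_symEntropy (hd : 0 < d) (x : Vec d) : gradient symEntropy x = symGrad x :=
  (hasGradientAt_symEntropy hd x).gradient

theorem bregman_symEntropy (hd : 0 < d) (y x : Vec d) :
    bregman symEntropy y x = symEntropy y - symEntropy x - inner ℝ (symGrad x) (y - x) := by
  rw [bregman, gradient_symEntropy hd]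

theorem l1Norm_nonneg (x : Vec d) : 0 ≤ l1Norm x := Finset.sum_nonneg fun _ _ => abs_nonneg _

theorem l1Norm_add_le (x y : Vec d) : l1Norm (x + y) ≤ l1Norm x + l1Norm y := by
  unfold l1Norm
  rw [← Finset.sum_add_distrib]
  exact Finset.sum_le_sum fun i _ => abs_add_le _ _

theorem l1Norm_smul (a : ℝ) (x : Vec d) : l1Norm (a • x) = |a| * l1Norm x := by
  simp [l1Norm, abs_mul, Finset.mul_sum]

theorem l1Norm_neg (x : Vec d) : l1Norm (-x) = l1Norm x := by simp [l1Norm]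

theorem l1Norm_sub_comm (x y : Vec d) : l1Norm (x - y) = l1Norm (y - x) := by
  rw [← l1Norm_neg, neg_sub]

theorem l1Norm_sub_le (x y z : Vec d) : l1Norm (x - z) ≤ l1Norm (x - y) + l1Norm (y - z) := by
  simpa using l1Norm_add_le (x - y) (y - z)

theorem continuous_l1Norm : Continuous (l1Norm : Vec d → ℝ) := by
  unfold l1Norm
  fun_prop

theorem norm_le_l1Norm (x : Vec d) : ‖x‖ ≤ l1Norm x := by
  rw [EuclideanSpace.norm_eq, Real.sqrt_le_left (l1Norm_nonneg x)]
  simpa [l1Norm] using Finset.sum_sq_le_sq_sum_of_nonneg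
    (s := Finset.univ) (f := fun i => |x i|) (fun _ _ => abs_nonneg _)

/-- The norm `‖x‖_∞`. -/
noncomputable def supNorm (x : Vec d) : ℝ := ‖WithLp.ofLp x‖

theorem supNorm_nonneg (x : Vec d) : 0 ≤ supNorm x := norm_nonneg _

theorem supNorm_add_le (x y : Vec d) : supNorm (x + y) ≤ supNorm x + supNorm y := norm_add_le _ _

theorem supNorm_sub_le (x y : Vec d) : supNorm (x - y) ≤ supNorm x + supNorm y := norm_sub_le _ _

theorem supNorm_smul (a : ℝ) (x : Vec d) : supNorm (a • x) = |a| * supNorm x := norm_smul _ _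

theorem abs_apply_le_supNorm (x : Vec d) (i : Fin d) : |x i| ≤ supNorm x :=
  norm_le_pi_norm (WithLp.ofLp x) i

theorem supNorm_le_iff {x : Vec d} {a : ℝ} (ha : 0 ≤ a) : supNorm x ≤ a ↔ ∀ i, |x i| ≤ a :=
  pi_norm_le_iff_of_nonneg ha

theorem supNorm_le_norm (x : Vec d) : supNorm x ≤ ‖x‖ :=
  (supNorm_le_iff (norm_nonneg x)).2 fun i => by
    simpa using PiLp.norm_apply_le x i

theorem continuous_supNorm : Continuous (supNorm : Vec d → ℝ) := by
  unfold supNorm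
  fun_prop

theorem abs_inner_le_supNorm_mul_l1Norm (x y : Vec d) :
    |inner ℝ x y| ≤ supNorm x * l1Norm y := by
  rw [inner_vec, l1Norm, Finset.mul_sum]
  refine (Finset.abs_sum_le_sum_abs _ _).trans (Finset.sum_le_sum fun i _ => ?_)
  rw [abs_mul]
  exact mul_le_mul_of_nonneg_right (abs_apply_le_supNorm x i) (abs_nonneg _)

theorem hasDerivAt_symEntropy_line (hd : 0 < d) (x h : Vec d) (s : ℝ) :
    HasDerivAt (fun s : ℝ => symEntropy (x + s • h)) (inner ℝ (symGrad (x + s • h)) h) s := by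
  have h1 := (hasGradientAt_symEntropy hd (x + s • h)).hasFDerivAt
  have h2 : HasDerivAt (fun s : ℝ => x + s • h) h s := by
    simpa using ((hasDerivAt_id s).smul_const h).const_add x
  exact h1.comp_hasDerivAt s h2

/-- Cauchy-Schwarz in the form `(∑ a)² / ∑ w ≤ ∑ a² / w`. The shifts `1/d` add up to `1`, which
makes the total weight `l1Norm z + 1`. -/
theorem sq_l1Norm_div_le (hd : 0 < d) {M : ℝ} (z h : Vec d) (hz : l1Norm z ≤ M) :
    l1Norm h ^ 2 / (M + 1) ≤ ∑ i, 1 / (|z i| + 1 / (d : ℝ)) * h i * h i := by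
  have hc : (0 : ℝ) < d := by exact_mod_cast hd
  have h1 := Finset.sq_sum_div_le_sum_sq_div (Finset.univ : Finset (Fin d)) (fun i => |h i|)
    (g := fun i => |z i| + 1 / (d : ℝ)) (fun i _ => by positivity)
  have h2 : ∑ i, (|z i| + 1 / (d : ℝ)) = l1Norm z + 1 := by
    rw [Finset.sum_add_distrib, l1Norm]
    simp [hc.ne']
  rw [h2] at h1
  calc l1Norm h ^ 2 / (M + 1) ≤ l1Norm h ^ 2 / (l1Norm z + 1) := by
        have := l1Norm_nonneg z
        gcongr
    _ ≤ _ := h1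
    _ = _ := Finset.sum_congr rfl fun i _ => by rw [sq_abs]; ring

theorem l1Norm_segment_le {M : ℝ} {x y : Vec d} (hx : l1Norm x ≤ M) (hy : l1Norm y ≤ M) {s : ℝ}
    (hs : s ∈ Set.Icc (0 : ℝ) 1) : l1Norm (x + s • (y - x)) ≤ M := by
  have : x + s • (y - x) = (1 - s) • x + s • y := by module
  rw [this]
  refine (l1Norm_add_le _ _).trans ?_
  rw [l1Norm_smul, l1Norm_smul, abs_of_nonneg hs.1, abs_of_nonneg (by linarith [hs.2])]
  nlinarith [hs.1, hs.2]

/-- Strong monotonicity of the gradient of the symmetric entropy on `ℓ₁`-balls. -/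
theorem symGrad_strongly_monotone (hd : 0 < d) {M : ℝ} {x y : Vec d}
    (hx : l1Norm x ≤ M) (hy : l1Norm y ≤ M) :
    l1Norm (y - x) ^ 2 / (M + 1) ≤ inner ℝ (symGrad y - symGrad x) (y - x) := by
  have hc : (0 : ℝ) < d := by exact_mod_cast hd
  set h := y - x with hh
  -- The derivative of `F` is the Hessian form along the segment minus its lower bound, hence
  -- nonnegative; compare `F 0` and `F 1`.
  set F : ℝ → ℝ := fun s =>
    inner ℝ (symGrad (x + s • h)) h - l1Norm h ^ 2 / (M + 1) * s with hF
  have hder : ∀ s, HasDerivAt F (∑ i, 1 / (|(x + s • h) i| + 1 / (d : ℝ)) * h i * h i -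
      l1Norm h ^ 2 / (M + 1)) s := by
    intro s
    have h1 : HasDerivAt (fun s : ℝ => inner ℝ (symGrad (x + s • h)) h)
        (∑ i, 1 / (|(x + s • h) i| + 1 / (d : ℝ)) * h i * h i) s := by
      simp only [inner_vec]
      refine HasDerivAt.fun_sum fun i _ => ?_
      have h2 : HasDerivAt (fun s : ℝ => (x + s • h) i) (h i) s := by
        simpa using ((hasDerivAt_id s).mul_const (h i)).const_add (x i)
      exact ((hasDerivAt_entropyTermDeriv hc ((x + s • h) i)).comp s h2).mul_const (h i)
    exact (h1.sub ((hasDerivAt_id s).const_mul (l1Norm h ^ 2 / (M + 1)))).congr_deriv (by rw [mul_one])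
  have hmono : MonotoneOn F (Set.Icc 0 1) := by
    refine monotoneOn_of_deriv_nonneg (convex_Icc 0 1)
      (fun s _ => (hder s).continuousAt.continuousWithinAt)
      (fun s _ => (hder s).differentiableAt.differentiableWithinAt) fun s hs => ?_
    rw [interior_Icc] at hs
    rw [(hder s).deriv, sub_nonneg]
    exact sq_l1Norm_div_le hd _ _ (l1Norm_segment_le hx hy ⟨hs.1.le, hs.2.le⟩)
  have := hmono (Set.left_mem_Icc.2 zero_le_one) (Set.right_mem_Icc.2 zero_le_one) zero_le_one
  simp only [hF, zero_smul, add_zero, one_smul, mul_zero, sub_zero, mul_one] at this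
  rw [inner_sub_left]
  have hy' : x + h = y := by simp [hh]
  rw [hy'] at this
  linarith

/-- Strong convexity of the symmetric entropy on `ℓ₁`-balls. -/
theorem bregman_symEntropy_ge (hd : 0 < d) {M : ℝ} {x y : Vec d}
    (hx : l1Norm x ≤ M) (hy : l1Norm y ≤ M) :
    l1Norm (y - x) ^ 2 / (2 * (M + 1)) ≤ bregman symEntropy y x := by
  set h := y - x with hh
  set a := l1Norm h ^ 2 / (M + 1) with ha
  -- Here `F' ≥ 0` is strong monotonicity between `x` and `x + s • h`, divided by `s`.
  set F : ℝ → ℝ := fun s => symEntropy (x + s • h) - s * inner ℝ (symGrad x) h - a / 2 * s ^ 2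
    with hF
  have hder : ∀ s, HasDerivAt F (inner ℝ (symGrad (x + s • h)) h - inner ℝ (symGrad x) h -
      a * s) s := by
    intro s
    have h1 := ((hasDerivAt_symEntropy_line hd x h s).sub
      ((hasDerivAt_id s).mul_const (inner ℝ (symGrad x) h))).sub
      ((hasDerivAt_pow 2 s).const_mul (a / 2))
    refine h1.congr_deriv ?_
    simp
    ring
  have hmono : MonotoneOn F (Set.Icc 0 1) := by
    refine monotoneOn_of_deriv_nonneg (convex_Icc 0 1)
      (fun s _ => (hder s).continuousAt.continuousWithinAt)
      (fun s _ => (hder s).differentiableAt.differentiableWithinAt) fun s hs => ?_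
    rw [interior_Icc] at hs
    rw [(hder s).deriv]
    have h1 := symGrad_strongly_monotone hd hx (l1Norm_segment_le hx hy ⟨hs.1.le, hs.2.le⟩)
    rw [add_sub_cancel_left, l1Norm_smul, inner_smul_right, inner_sub_left,
      abs_of_pos hs.1] at h1
    have h2 : (s * l1Norm h) ^ 2 / (M + 1) = s * (a * s) := by rw [ha]; ring
    rw [← hh, h2] at h1
    have := le_of_mul_le_mul_left h1 hs.1
    linarith
  have := hmono (Set.left_mem_Icc.2 zero_le_one) (Set.right_mem_Icc.2 zero_le_one) zero_le_one
  have hy' : x + h = y := by simp [hh]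
  simp only [hF, zero_smul, add_zero, one_smul, hy'] at this
  rw [bregman_symEntropy hd, ← hh]
  have h3 : l1Norm h ^ 2 / (2 * (M + 1)) = a / 2 := by
    rw [ha, mul_comm, div_mul_eq_div_div]
  rw [h3]
  linarith

theorem bregman_self (ψ : Vec d → ℝ) (x : Vec d) : bregman ψ x x = 0 := by simp [bregman]

theorem continuous_bregman_symEntropy (hd : 0 < d) (x : Vec d) :
    Continuous fun y => bregman symEntropy y x := by
  have := continuous_symEntropy hd
  unfold bregman
  fun_prop

theorem supNorm_symGrad_le (hd : 0 < d) {M : ℝ} {x : Vec d} (hx : l1Norm x ≤ M) :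
    supNorm (symGrad x) ≤ Real.log (d * M + 1) := by
  have hc : (0 : ℝ) < d := by exact_mod_cast hd
  have hM : 0 ≤ M := (l1Norm_nonneg x).trans hx
  refine (supNorm_le_iff (Real.log_nonneg (by nlinarith))).2 fun i => ?_
  have h1 : |x i| ≤ M := (Finset.single_le_sum (f := fun i => |x i|)
    (fun _ _ => abs_nonneg _) (Finset.mem_univ i)).trans hx
  simp only [symGrad]
  rw [abs_entropyTermDeriv hc]
  gcongr

end SymEntropy

/-! ### The mirror step: existence, optimality, descent and stability. -/

section Prox

variable {d : ℕ} {K : Set (Vec d)} {r : Vec d → ℝ}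

theorem continuous_of_convexOn_univ (hr : ConvexOn ℝ Set.univ r) : Continuous r :=
  continuousOn_univ.1 (hr.continuousOn isOpen_univ)

theorem continuous_proxObjective (hd : 0 < d) (hr : Continuous r) (x g : Vec d) (η : ℝ) :
    Continuous fun y => inner ℝ g y + r y + η * bregman symEntropy y x := by
  have := continuous_bregman_symEntropy hd x
  fun_prop

theorem isCompact_inter_l1Ball (hK : IsClosed K) (x : Vec d) (ρ : ℝ) :
    IsCompact (K ∩ {y | l1Norm (y - x) ≤ ρ}) := by
  refine Metric.isCompact_of_isClosed_isBounded (hK.inter (isClosed_le ?_ continuous_const)) ?_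
  · exact continuous_l1Norm.comp (continuous_id.sub continuous_const)
  · refine (Metric.isBounded_closedBall (x := x) (r := ρ)).subset fun y hy => ?_
    rw [mem_closedBall_iff_norm]
    exact (norm_le_l1Norm _).trans hy.2

/-- A lower bound that needs no a priori bound on `y`. It grows linearly in `l1Norm (y - x)`, which
for large `η` beats the linear decay allowed to `r`. -/
theorem bregman_symEntropy_ge_of_l1Norm (hd : 0 < d) (x y : Vec d) :
    l1Norm (y - x) ^ 2 / (2 * (l1Norm x + 1 + l1Norm (y - x))) ≤ bregman symEntropy y x := by
  have hn := l1Norm_nonneg (y - x)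
  have h := bregman_symEntropy_ge hd (x := x) (y := y) (M := l1Norm x + l1Norm (y - x))
    (by linarith) (by simpa using l1Norm_add_le x (y - x))
  rwa [add_right_comm] at h

/-- If `r` is bounded below on `K` by a function of linear growth, then the mirror step with zero
gradient and large step parameter is well defined. -/
theorem exists_isMirrorProx_zero (hd : 0 < d) (hK : IsClosed K) (hr : Continuous r) {x : Vec d}
    (hx : x ∈ K) {b c η : ℝ} (hc : 0 ≤ c)
    (hlow : ∀ y ∈ K, r x - b - c * l1Norm (y - x) ≤ r y) (hη : 4 * c + 4 ≤ η) :
    ∃ p, IsMirrorProx K r symEntropy x 0 η p := by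
  -- Beyond radius `ρ`, the first entry gives divergence at least `n / 4` and the second gives `n >
  -- b`, so such points are worse than `x`; the minimum over the compact ball is then global.
  set ρ := max (l1Norm x + 1) (b + 1) with hρ
  have hA := l1Norm_nonneg x
  have hxmem : x ∈ K ∩ {y | l1Norm (y - x) ≤ ρ} := by
    refine ⟨hx, ?_⟩
    have : (0 : ℝ) ≤ ρ := le_max_of_le_left (by positivity)
    simpa [l1Norm] using this
  obtain ⟨p, hp, hmin⟩ := (isCompact_inter_l1Ball hK x ρ).exists_isMinOn ⟨x, hxmem⟩
    (continuous_proxObjective hd hr x 0 η).continuousOn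
  refine ⟨p, hp.1, fun y hy => ?_⟩
  by_cases hyρ : l1Norm (y - x) ≤ ρ
  · exact hmin ⟨hy, hyρ⟩
  · have hpx := hmin hxmem
    simp only [Set.mem_ofPred_eq, bregman_self, inner_zero_left, mul_zero, add_zero,
      zero_add] at hpx ⊢
    set n := l1Norm (y - x) with hn
    push Not at hyρ
    have hn1 : l1Norm x + 1 ≤ n := (le_max_left _ _).trans hyρ.le
    have hn2 : b + 1 ≤ n := (le_max_right _ _).trans hyρ.le
    have hB := bregman_symEntropy_ge_of_l1Norm hd x y
    have hB' : n / 4 ≤ bregman symEntropy y x := by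
      refine le_trans ?_ hB
      rw [← hn, le_div_iff₀ (by linarith)]
      nlinarith
    have h2 := hlow y hy
    have h3 : (4 * c + 4) * (n / 4) ≤ η * bregman symEntropy y x :=
      mul_le_mul hη hB' (by linarith) (by linarith)
    linarith

/-- A bound on the outputs of the mirror step is a bound on the whole set. -/
theorem l1Norm_le_of_mirrorProx_le (hd : 0 < d) (hK : IsClosed K) (hr : Continuous r) {b c D : ℝ}
    (hb : 0 ≤ b) (hc : 0 ≤ c) (hD0 : 0 ≤ D)
    (hlow : ∀ x ∈ K, ∀ y ∈ K, r x - b - c * l1Norm (y - x) ≤ r y)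
    (hD : ∀ x ∈ K, ∀ (g : Vec d) (η : ℝ), 0 < η → l1Norm (mirrorProx K r symEntropy x g η) ≤ D)
    {x : Vec d} (hx : x ∈ K) : l1Norm x ≤ D := by
  refine le_of_forall_pos_le_add fun ε hε => ?_
  have hA := l1Norm_nonneg x
  set n₀ := D + l1Norm x with hn₀
  set B := 2 * (l1Norm x + 1 + n₀) * (b + c * n₀) with hB
  have hB0 : 0 ≤ B := by positivity
  -- The first entry ensures that a minimiser exists, so that the `Classical.epsilon` value is one;
  -- the second forces it within `ε` of `x`.
  set η := max (4 * c + 4) (B / ε ^ 2) with hη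
  have hη0 : 0 < η := lt_max_of_lt_left (by positivity)
  obtain ⟨hq, hmin⟩ : IsMirrorProx K r symEntropy x 0 η (mirrorProx K r symEntropy x 0 η) :=
    Classical.epsilon_spec (p := IsMirrorProx K r symEntropy x 0 η)
      (exists_isMirrorProx_zero hd hK hr hx hc (hlow x hx) (le_max_left _ _))
  have hpD := hD x hx 0 η hη0
  set q := mirrorProx K r symEntropy x 0 η
  have hpx := hmin hx
  simp only [Set.mem_ofPred_eq, bregman_self, inner_zero_left, mul_zero, add_zero,
    zero_add] at hpx
  have h1 := hlow x hx q hq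
  have h2 := bregman_symEntropy_ge_of_l1Norm hd x q
  set n := l1Norm (q - x) with hn
  have hn0 : 0 ≤ n := l1Norm_nonneg _
  have hnn : n ≤ n₀ := by
    have := l1Norm_add_le q (-x)
    rw [l1Norm_neg, ← sub_eq_add_neg] at this
    linarith
  have h3 : η * bregman symEntropy q x ≤ b + c * n₀ := by nlinarith
  have h4 : η * (n ^ 2 / (2 * (l1Norm x + 1 + n₀))) ≤ b + c * n₀ := by
    refine le_trans (mul_le_mul_of_nonneg_left (le_trans ?_ h2) hη0.le) h3
    gcongr
  have h5 : η * n ^ 2 ≤ B := by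
    rw [← mul_div_assoc, div_le_iff₀ (by positivity)] at h4
    linarith
  have h6 : B ≤ η * ε ^ 2 := by
    rw [← div_le_iff₀ (by positivity)]
    exact le_max_right _ _
  have h7 : n ≤ ε := by
    have : n ^ 2 ≤ ε ^ 2 := le_of_mul_le_mul_left (h5.trans h6) hη0
    exact (pow_le_pow_iff_left₀ hn0 hε.le two_ne_zero).1 this
  have h8 := l1Norm_add_le q (x - q)
  rw [add_sub_cancel, l1Norm_sub_comm] at h8
  linarith

/-- A closed `ℓ₁`-bounded `K` is compact, so the minimum is attained for every `g` and `η` and the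
choice in `mirrorProx` is a genuine minimiser. -/
theorem isMirrorProx_mirrorProx (hd : 0 < d) (hK : IsClosed K) (hr : Continuous r) {D : ℝ}
    (hKD : ∀ x ∈ K, l1Norm x ≤ D) {x : Vec d} (hx : x ∈ K) (g : Vec d) (η : ℝ) :
    IsMirrorProx K r symEntropy x g η (mirrorProx K r symEntropy x g η) := by
  refine Classical.epsilon_spec (p := IsMirrorProx K r symEntropy x g η) ?_
  have hcomp : IsCompact K := by
    have h := isCompact_inter_l1Ball hK (0 : Vec d) D
    rwa [Set.inter_eq_left.2 fun y hy => by simpa using hKD y hy] at h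
  obtain ⟨p, hp, hmin⟩ := hcomp.exists_isMinOn ⟨x, hx⟩
    (continuous_proxObjective hd hr x g η).continuousOn
  exact ⟨p, hp, hmin⟩

theorem HasDerivAt.nonneg_of_le_on_Ioc {F : ℝ → ℝ} {F' : ℝ} (hF : HasDerivAt F F' 0)
    (h : ∀ s ∈ Set.Ioc (0 : ℝ) 1, F 0 ≤ F s) : 0 ≤ F' := by
  have h1 := (hF.hasDerivWithinAt (s := Set.Ioi 0))
  rw [hasDerivWithinAt_iff_tendsto_slope' (by simp)] at h1
  refine ge_of_tendsto h1 ?_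
  filter_upwards [Ioc_mem_nhdsGT (zero_lt_one' ℝ)] with s hs
  rw [slope_def_field]
  exact div_nonneg (sub_nonneg.2 (h s hs)) (by linarith [hs.1])

/-- First-order optimality condition of the mirror step. -/
theorem IsMirrorProx.variational_inequality (hd : 0 < d) (hK : Convex ℝ K)
    (hr : ConvexOn ℝ Set.univ r) {x g p : Vec d} {η : ℝ}
    (hp : IsMirrorProx K r symEntropy x g η p) {y : Vec d} (hy : y ∈ K) :
    0 ≤ inner ℝ (g + η • (symGrad p - symGrad x)) (y - p) + (r y - r p) := by
  obtain ⟨hpK, hmin⟩ := hp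
  set h := y - p with hh
  -- Along the segment `r` is replaced by its chord. This keeps the value at `s = 0`, can only raise
  -- the others, and makes the function differentiable, so its derivative at the minimum `s = 0` is
  -- nonnegative.
  have hder : HasDerivAt (fun s : ℝ => s * (inner ℝ g h + (r y - r p) - η * inner ℝ (symGrad x) h)
      + η * symEntropy (p + s • h))
      (inner ℝ g h + (r y - r p) - η * inner ℝ (symGrad x) h + η * inner ℝ (symGrad p) h) 0 := by
    have h1 := hasDerivAt_symEntropy_line hd p h 0
    rw [zero_smul, add_zero] at h1
    refine (((hasDerivAt_id (0 : ℝ)).mul_const _).add (h1.const_mul η)).congr_deriv (by simp)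
  have := hder.nonneg_of_le_on_Ioc fun s hs => ?_
  · rw [inner_add_left, inner_smul_left, inner_sub_left]
    simp only [conj_trivial]
    linarith
  · have hq : p + s • h = (1 - s) • p + s • y := by rw [hh]; module
    have hqK : p + s • h ∈ K := by
      rw [hq]
      exact hK hpK hy (by linarith [hs.2]) hs.1.le (by ring)
    have hrq : r (p + s • h) ≤ (1 - s) * r p + s * r y := by
      rw [hq]
      exact hr.2 (Set.mem_univ _) (Set.mem_univ _) (by linarith [hs.2]) hs.1.le (by ring)
    have h2 := hmin hqK
    simp only [Set.mem_ofPred_eq, bregman_symEntropy hd] at h2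
    have h3 : p + s • h - x = (p - x) + s • h := by abel
    rw [h3, inner_add_right, inner_add_right, inner_smul_right, inner_smul_right] at h2
    simp only [zero_mul, zero_smul, add_zero, zero_add]
    nlinarith

/-- Descent of the mirror step. -/
theorem IsMirrorProx.descent (hd : 0 < d) (hK : Convex ℝ K)
    (hr : ConvexOn ℝ Set.univ r) {x g p : Vec d} {η : ℝ} (hη : 0 ≤ η)
    (hp : IsMirrorProx K r symEntropy x g η p) (hx : x ∈ K) {M : ℝ} (hxM : l1Norm x ≤ M)
    (hpM : l1Norm p ≤ M) :
    inner ℝ g (p - x) + (r p - r x) ≤ -(η * (l1Norm (p - x) ^ 2 / (M + 1))) := by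
  have h1 := hp.variational_inequality hd hK hr hx
  have h2 := mul_le_mul_of_nonneg_left (symGrad_strongly_monotone hd hxM hpM) hη
  rw [← neg_sub p x, inner_neg_right, inner_add_left, inner_smul_left] at h1
  simp only [conj_trivial] at h1
  linarith

/-- Stability of the mirror step under perturbation of all its arguments. -/
theorem IsMirrorProx.stability (hd : 0 < d) (hK : Convex ℝ K)
    (hr : ConvexOn ℝ Set.univ r) {D : ℝ} (hKD : ∀ x ∈ K, l1Norm x ≤ D)
    {x g p x' g' p' : Vec d} {η η' : ℝ} (hη : 0 < η)
    (hp : IsMirrorProx K r symEntropy x g η p) (hp' : IsMirrorProx K r symEntropy x' g' η' p') :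
    l1Norm (p - p') ≤ (D + 1) / η * supNorm (g - g' + (η - η') • symGrad p' -
      (η • symGrad x - η' • symGrad x')) := by
  have hD0 : 0 ≤ D := (l1Norm_nonneg p).trans (hKD p hp.1)
  have h1 := hp.variational_inequality hd hK hr hp'.1
  have h2 := hp'.variational_inequality hd hK hr hp.1
  set w := g - g' + (η - η') • symGrad p' - (η • symGrad x - η' • symGrad x') with hw
  have h3 := mul_le_mul_of_nonneg_left
    (symGrad_strongly_monotone hd (hKD p hp.1) (hKD p' hp'.1)) hη.le
  -- Each minimiser is tested against the other, so the `r` terms cancel in the sum. Writing `η'` as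
  -- `η - (η - η')` isolates the strongly monotone term and leaves `w` as the perturbation.
  have h4 : inner ℝ (g + η • (symGrad p - symGrad x)) (p' - p) +
      inner ℝ (g' + η' • (symGrad p' - symGrad x')) (p - p') =
      inner ℝ w (p' - p) - η * inner ℝ (symGrad p' - symGrad p) (p' - p) := by
    rw [← neg_sub p' p, inner_neg_right, ← sub_eq_add_neg, ← inner_sub_left,
      ← real_inner_smul_left, ← inner_sub_left]
    congr 1
    rw [hw]
    module
  have h5 := (le_abs_self _).trans (abs_inner_le_supNorm_mul_l1Norm w (p' - p))
  rw [l1Norm_sub_comm p p']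
  set n := l1Norm (p' - p) with hn
  have hn0 : 0 ≤ n := l1Norm_nonneg _
  have h6 : η * (n ^ 2 / (D + 1)) ≤ supNorm w * n := by linarith
  rcases hn0.eq_or_lt with h0 | h0
  · rw [← h0]
    have := supNorm_nonneg w
    positivity
  · rw [← mul_div_assoc, div_le_iff₀ (by positivity)] at h6
    rw [div_mul_eq_mul_div, le_div_iff₀ hη]
    have h7 : n * (η * n) ≤ n * (supNorm w * (D + 1)) := by linarith
    have := le_of_mul_le_mul_left h7 h0
    linarith

/-- The mirror step is Lipschitz in the gradient. -/
theorem IsMirrorProx.lipschitz (hd : 0 < d) (hK : Convex ℝ K)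
    (hr : ConvexOn ℝ Set.univ r) {D : ℝ} (hKD : ∀ x ∈ K, l1Norm x ≤ D)
    {x g p g' p' : Vec d} {η : ℝ} (hη : 0 < η)
    (hp : IsMirrorProx K r symEntropy x g η p) (hp' : IsMirrorProx K r symEntropy x g' η p') :
    η / (D + 1) * l1Norm (p - p') ≤ supNorm (g - g') := by
  have hD0 : 0 ≤ D := (l1Norm_nonneg p).trans (hKD p hp.1)
  have h := hp.stability hd hK hr hKD hη hp'
  simp only [sub_self, zero_smul, add_zero, sub_zero] at h
  rw [div_mul_eq_mul_div, le_div_iff₀ hη] at h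
  rw [div_mul_eq_mul_div, div_le_iff₀ (by positivity)]
  linarith

/-- Needed for measurability of the iterates, since `mirrorProx` is defined by choice. -/
theorem continuousOn_mirrorProx (hd : 0 < d) (hKc : IsClosed K) (hK : Convex ℝ K)
    (hr : ConvexOn ℝ Set.univ r) {D : ℝ} (hKD : ∀ x ∈ K, l1Norm x ≤ D) :
    ContinuousOn (fun q : Vec d × Vec d × ℝ => mirrorProx K r symEntropy q.1 q.2.1 q.2.2)
      (K ×ˢ (Set.univ ×ˢ Set.Ioi 0)) := by
  rintro ⟨x, g, η⟩ ⟨hx, -, hη⟩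
  simp only [Set.mem_Ioi] at hx hη
  have hspec : ∀ q : Vec d × Vec d × ℝ, q.1 ∈ K → IsMirrorProx K r symEntropy q.1 q.2.1 q.2.2
      (mirrorProx K r symEntropy q.1 q.2.1 q.2.2) := fun q hq =>
    isMirrorProx_mirrorProx hd hKc (continuous_of_convexOn_univ hr) hKD hq _ _
  -- The right side of `IsMirrorProx.stability` with the unknown `symGrad p'` bounded uniformly over
  -- `K`; it is continuous in `q` and vanishes at the base point.
  set b : Vec d × Vec d × ℝ → ℝ := fun q => (D + 1) / η * (supNorm (g - q.2.1) +
    |η - q.2.2| * Real.log (d * D + 1) + supNorm (η • symGrad x - q.2.2 • symGrad q.1)) with hb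
  have hbcont : Continuous b := by
    have h1 := continuous_supNorm (d := d)
    have h2 := continuous_symGrad hd
    rw [hb]
    fun_prop
  have hb0 : b (x, g, η) = 0 := by simp [hb, supNorm]
  rw [ContinuousWithinAt, tendsto_iff_norm_sub_tendsto_zero]
  refine squeeze_zero' (Filter.Eventually.of_forall fun _ => norm_nonneg _) (g := b) ?_ ?_
  · filter_upwards [self_mem_nhdsWithin] with q hq
    have h := (hspec (x, g, η) hx).stability hd hK hr hKD hη (hspec q hq.1)
    rw [norm_sub_rev]
    refine (norm_le_l1Norm _).trans (h.trans ?_)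
    have hD0 : 0 ≤ D := (l1Norm_nonneg _).trans (hKD x hx)
    refine mul_le_mul_of_nonneg_left ?_ (by positivity)
    refine (supNorm_sub_le _ _).trans (add_le_add_left ((supNorm_add_le _ _).trans ?_) _)
    refine add_le_add_right ?_ _
    rw [supNorm_smul]
    exact mul_le_mul_of_nonneg_left (supNorm_symGrad_le hd (hKD _ (hspec q hq.1).1))
      (abs_nonneg _)
  · have := hbcont.tendsto (x, g, η)
    rw [hb0] at this
    exact this.mono_left nhdsWithin_le_nhds

theorem bregman_const_mul (hd : 0 < d) (c : ℝ) (y x : Vec d) :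
    bregman (fun y => c * symEntropy y) y x = c * bregman symEntropy y x := by
  have h : HasGradientAt (fun y => c * symEntropy y) (c • symGrad x) x := by
    rw [hasGradientAt_iff_hasFDerivAt]
    have := (hasGradientAt_symEntropy hd x).hasFDerivAt.const_mul c
    simpa using this
  rw [bregman, h.gradient, bregman_symEntropy hd, real_inner_smul_left]
  ring

/-- The two scalings cancel in the objective, so the analysis can run with `symEntropy` alone and
meet the factor `D + 1` only in the final gradient map. -/
theorem mirrorProx_const_mul (hd : 0 < d) {c : ℝ} (hc : c ≠ 0) (x g : Vec d) (η : ℝ) :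
    mirrorProx K r (fun y => c * symEntropy y) x g (η / c) = mirrorProx K r symEntropy x g η := by
  unfold mirrorProx
  congr 1
  funext p
  unfold IsMirrorProx
  simp only [bregman_const_mul hd, ← mul_assoc, div_mul_cancel₀ η hc]

end Prox

/-! ### The quadratic Taylor bound for functions with Lipschitz gradient. -/

section Smooth

variable {d : ℕ}

theorem norm_gradient_eq_norm_fderiv (f : Vec d → ℝ) (x : Vec d) :
    ‖gradient f x‖ = ‖fderiv ℝ f x‖ := by
  simp [gradient]

theorem hasDerivAt_line {f : Vec d → ℝ} (hf : Differentiable ℝ f) (x h : Vec d) (s : ℝ) :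
    HasDerivAt (fun s : ℝ => f (x + s • h)) (inner ℝ (gradient f (x + s • h)) h) s := by
  have h1 := (hf (x + s • h)).hasGradientAt.hasFDerivAt
  have h2 : HasDerivAt (fun s : ℝ => x + s • h) h s := by
    simpa using ((hasDerivAt_id s).smul_const h).const_add x
  exact h1.comp_hasDerivAt s h2

theorem abs_taylor_le_of_lipschitz_gradient {f : Vec d → ℝ} {L : ℝ} (hf : Differentiable ℝ f)
    (hL : ∀ x y, ‖gradient f x - gradient f y‖ ≤ L * ‖x - y‖) (x y : Vec d) :
    |f y - f x - inner ℝ (gradient f x) (y - x)| ≤ L / 2 * ‖y - x‖ ^ 2 := by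
  set h := y - x with hh
  have hin : ∀ s : ℝ, 0 < s → |inner ℝ (gradient f (x + s • h)) h - inner ℝ (gradient f x) h| ≤
      L * ‖h‖ ^ 2 * s := by
    intro s hs
    rw [← inner_sub_left]
    refine (abs_real_inner_le_norm _ _).trans ?_
    have := hL (x + s • h) x
    rw [add_sub_cancel_left, norm_smul, Real.norm_of_nonneg hs.le] at this
    nlinarith [mul_le_mul_of_nonneg_right this (norm_nonneg h)]
  -- The sign `c = ±1` yields both sides of the absolute value from a single monotonicity argument.
  have key : ∀ c : ℝ, |c| = 1 →
      0 ≤ L / 2 * ‖h‖ ^ 2 + c * (f y - f x - inner ℝ (gradient f x) h) := by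
    intro c hc
    set F : ℝ → ℝ := fun s =>
      L * ‖h‖ ^ 2 / 2 * s ^ 2 + c * (f (x + s • h) - s * inner ℝ (gradient f x) h) with hF
    have hder : ∀ s, HasDerivAt F (L * ‖h‖ ^ 2 * s +
        c * (inner ℝ (gradient f (x + s • h)) h - inner ℝ (gradient f x) h)) s := by
      intro s
      have h1 := ((hasDerivAt_pow 2 s).const_mul (L * ‖h‖ ^ 2 / 2)).add
        (((hasDerivAt_line hf x h s).sub
          ((hasDerivAt_id s).mul_const (inner ℝ (gradient f x) h))).const_mul c)
      refine h1.congr_deriv ?_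
      simp
      ring
    have hmono : MonotoneOn F (Set.Icc 0 1) := by
      refine monotoneOn_of_deriv_nonneg (convex_Icc 0 1)
        (fun s _ => (hder s).continuousAt.continuousWithinAt)
        (fun s _ => (hder s).differentiableAt.differentiableWithinAt) fun s hs => ?_
      rw [interior_Icc] at hs
      rw [(hder s).deriv]
      have h1 := hin s hs.1
      have h2 := neg_abs_le
        (c * (inner ℝ (gradient f (x + s • h)) h - inner ℝ (gradient f x) h))
      rw [abs_mul, hc, one_mul] at h2
      linarith
    have := hmono (Set.left_mem_Icc.2 zero_le_one) (Set.right_mem_Icc.2 zero_le_one) zero_le_one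
    have hy' : x + h = y := by simp [hh]
    simp only [hF, zero_smul, add_zero, one_smul, hy'] at this
    linarith
  rw [abs_le]
  have h1 := key 1 (by simp)
  have h2 := key (-1) (by simp)
  constructor <;> linarith

end Smooth

/-! ### Regularity inherited by the expected loss. -/

section ExpLoss

variable {d : ℕ} {Ξ : Type*} {l : Vec d → Ξ → ℝ} {G L : ℝ}

theorem exists_norm_sub_eq_one (hd : 0 < d) : ∃ x y : Vec d, ‖x - y‖ = 1 :=
  ⟨EuclideanSpace.single ⟨0, hd⟩ 1, 0, by simp⟩

theorem IsSmoothLoss.lipschitzConst_nonneg [Nonempty Ξ] (hd : 0 < d) (h : IsSmoothLoss l G L) :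
    0 ≤ G := by
  obtain ⟨x, y, hxy⟩ := exists_norm_sub_eq_one hd
  have := h.lipschitz (Classical.arbitrary Ξ) x y
  rw [hxy, mul_one] at this
  exact (abs_nonneg _).trans this

theorem IsSmoothLoss.smoothConst_nonneg [Nonempty Ξ] (hd : 0 < d) (h : IsSmoothLoss l G L) :
    0 ≤ L := by
  obtain ⟨x, y, hxy⟩ := exists_norm_sub_eq_one hd
  have := h.lipschitz_gradient (Classical.arbitrary Ξ) x y
  rw [hxy, mul_one] at this
  exact (norm_nonneg _).trans this

theorem IsSmoothLoss.norm_gradient_le (hG : 0 ≤ G) (h : IsSmoothLoss l G L) (ξ : Ξ) (x : Vec d) :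
    ‖gradient (fun z => l z ξ) x‖ ≤ G := by
  rw [norm_gradient_eq_norm_fderiv]
  exact norm_fderiv_le_of_lip' ℝ hG (Filter.Eventually.of_forall fun y => h.lipschitz ξ y x)

theorem IsSmoothLoss.abs_taylor_le (h : IsSmoothLoss l G L) (ξ : Ξ) (x y : Vec d) :
    |l y ξ - l x ξ - inner ℝ (gradient (fun z => l z ξ) x) (y - x)| ≤ L / 2 * ‖y - x‖ ^ 2 :=
  abs_taylor_le_of_lipschitz_gradient (h.differentiable ξ) (h.lipschitz_gradient ξ) x y

variable [MeasurableSpace Ξ] {𝒟 : Measure Ξ}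

/-- Each coordinate is a pointwise limit of difference quotients with steps `1/(n+1)`, which are
measurable in `ξ`. -/
theorem measurable_gradient (h : IsSmoothLoss l G L) (hm : ∀ x, Measurable (l x)) (x : Vec d) :
    Measurable fun ξ => gradient (fun z => l z ξ) x := by
  have key : ∀ i, Measurable fun ξ => gradient (fun z => l z ξ) x i := by
    intro i
    set e : Vec d := EuclideanSpace.single i 1
    refine measurable_of_tendsto_metrizable
      (f := fun (n : ℕ) ξ => ((n : ℝ) + 1) * (l (x + ((n : ℝ) + 1)⁻¹ • e) ξ - l x ξ))
      (fun n => ((hm _).sub (hm _)).const_mul _) ?_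
    rw [tendsto_pi_nhds]
    intro ξ
    have h1 := hasDerivAt_line (h.differentiable ξ) x e 0
    rw [hasDerivAt_iff_tendsto_slope_zero] at h1
    have h2 : Filter.Tendsto (fun n : ℕ => ((n : ℝ) + 1)⁻¹) Filter.atTop (nhdsWithin 0 {0}ᶜ) := by
      refine tendsto_nhdsWithin_iff.2 ⟨?_, Filter.Eventually.of_forall fun n => ?_⟩
      · simpa using tendsto_one_div_add_atTop_nhds_zero_nat (𝕜 := ℝ)
      · simp
        positivity
    have h3 := h1.comp h2
    have h4 : inner ℝ (gradient (fun z => l z ξ) (x + (0 : ℝ) • e)) e =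
        gradient (fun z => l z ξ) x i := by
      rw [zero_smul, add_zero, EuclideanSpace.inner_single_right]
      simp
    rw [h4] at h3
    simpa [Function.comp_def] using h3
  have : Measurable fun ξ => WithLp.toLp 2 (fun i => gradient (fun z => l z ξ) x i) :=
    (WithLp.measurable_toLp 2 _).comp (measurable_pi_iff.2 key)
  exact this

variable [IsProbabilityMeasure 𝒟]

theorem integrable_gradient (hG : 0 ≤ G) (h : IsSmoothLoss l G L) (hm : ∀ x, Measurable (l x))
    (x : Vec d) : Integrable (fun ξ => gradient (fun z => l z ξ) x) 𝒟 :=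
  Integrable.of_bound (measurable_gradient h hm x).aestronglyMeasurable G
    (Filter.Eventually.of_forall fun ξ => h.norm_gradient_le hG ξ x)

theorem abs_expLoss_sub_le (h : IsSmoothLoss l G L) (hu : IsUnbiasedLoss 𝒟 l) (x y : Vec d) :
    |expLoss 𝒟 l x - expLoss 𝒟 l y| ≤ G * ‖x - y‖ := by
  unfold expLoss
  rw [← integral_sub (hu.integrable x) (hu.integrable y)]
  simpa using norm_integral_le_of_norm_le_const (μ := 𝒟) (f := fun ξ => l x ξ - l y ξ)
    (Filter.Eventually.of_forall fun ξ => h.lipschitz ξ x y)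

theorem norm_gradient_expLoss_le (hG : 0 ≤ G) (h : IsSmoothLoss l G L)
    (hu : IsUnbiasedLoss 𝒟 l) (x : Vec d) : ‖gradient (expLoss 𝒟 l) x‖ ≤ G := by
  rw [← hu.unbiased]
  simpa using norm_integral_le_of_norm_le_const (μ := 𝒟)
    (Filter.Eventually.of_forall fun ξ => h.norm_gradient_le hG ξ x)

theorem gradient_expLoss_lipschitz (hG : 0 ≤ G) (h : IsSmoothLoss l G L)
    (hu : IsUnbiasedLoss 𝒟 l) (x y : Vec d) :
    ‖gradient (expLoss 𝒟 l) x - gradient (expLoss 𝒟 l) y‖ ≤ L * ‖x - y‖ := by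
  rw [← hu.unbiased, ← hu.unbiased, ← integral_sub (integrable_gradient hG h hu.measurable x)
    (integrable_gradient hG h hu.measurable y)]
  simpa using norm_integral_le_of_norm_le_const (μ := 𝒟)
    (Filter.Eventually.of_forall fun ξ => h.lipschitz_gradient ξ x y)

theorem continuous_gradient_expLoss (hG : 0 ≤ G) (h : IsSmoothLoss l G L)
    (hu : IsUnbiasedLoss 𝒟 l) : Continuous (gradient (expLoss 𝒟 l)) := by
  refine LipschitzWith.continuous (K := L.toNNReal) (LipschitzWith.of_dist_le_mul fun x y => ?_)
  rw [dist_eq_norm, dist_eq_norm]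
  refine (gradient_expLoss_lipschitz hG h hu x y).trans ?_
  gcongr
  exact Real.le_coe_toNNReal L

/-- The Taylor bound is integrated over `ξ`; unbiasedness identifies the linear term, so no
differentiation under the integral is needed. -/
theorem expLoss_taylor_le (hG : 0 ≤ G) (h : IsSmoothLoss l G L)
    (hu : IsUnbiasedLoss 𝒟 l) (x y : Vec d) :
    expLoss 𝒟 l y - expLoss 𝒟 l x - inner ℝ (gradient (expLoss 𝒟 l) x) (y - x) ≤
      L / 2 * ‖y - x‖ ^ 2 := by
  have hi := integrable_gradient (𝒟 := 𝒟) hG h hu.measurable x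
  rw [← hu.unbiased, real_inner_comm, ← integral_inner hi, expLoss, expLoss,
    ← integral_sub (hu.integrable y) (hu.integrable x),
    ← integral_sub (f := fun ξ => l y ξ - l x ξ) ((hu.integrable y).sub (hu.integrable x))
      (hi.const_inner _)]
  refine (le_abs_self _).trans ?_
  have := norm_integral_le_of_norm_le_const (μ := 𝒟)
    (f := fun ξ => l y ξ - l x ξ - inner ℝ (y - x) (gradient (fun z => l z ξ) x))
    (Filter.Eventually.of_forall fun ξ => by
      rw [real_inner_comm]; exact h.abs_taylor_le ξ x y)
  simpa using this

end ExpLoss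

/-! ### Scalar inequalities for adaptive step sizes. -/

section Deterministic

/-- Each term is at most twice the increment of the root of the partial sums, and these increments
telescope. A vanishing denominator contributes `0` by convention. -/
theorem sum_div_sqrt_sum_le (a : ℕ → ℝ) (ha : ∀ t, 0 ≤ a t) (n : ℕ) :
    ∑ t ∈ Finset.range n, a t / √(∑ s ∈ Finset.range (t + 1), a s) ≤
      2 * √(∑ t ∈ Finset.range n, a t) := by
  induction n with
  | zero => simp
  | succ n ih =>
    rw [Finset.sum_range_succ]
    set A := ∑ s ∈ Finset.range n, a s with hA
    have hA0 : 0 ≤ A := Finset.sum_nonneg fun t _ => ha t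
    have hB : ∑ s ∈ Finset.range (n + 1), a s = A + a n := Finset.sum_range_succ _ _
    rw [hB]
    have hB0 : 0 ≤ A + a n := add_nonneg hA0 (ha n)
    have h1 : a n / √(A + a n) ≤ 2 * (√(A + a n) - √A) := by
      rcases hB0.eq_or_lt with h0 | h0
      · have h3 := ha n
        have h2 : A = 0 := by linarith
        rw [← h0, h2]
        simp
      · rw [div_le_iff₀ (Real.sqrt_pos.2 h0)]
        nlinarith [Real.mul_self_sqrt hB0, Real.mul_self_sqrt hA0, sq_nonneg (√(A + a n) - √A)]
    linarith

/-- Summation by parts with nondecreasing weights; the sharper bound `α k * (R - f k)` is what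
survives the induction. -/
theorem sum_mul_sub_le (α f : ℕ → ℝ) {R : ℝ} (n : ℕ) (hα0 : 0 ≤ α 0)
    (hα : ∀ t < n, α t ≤ α (t + 1)) (hf0 : ∀ t ≤ n, 0 ≤ f t) (hfR : ∀ t ≤ n, f t ≤ R) :
    ∑ t ∈ Finset.range n, α (t + 1) * (f t - f (t + 1)) ≤ α n * R := by
  have key : ∀ k ≤ n, ∑ t ∈ Finset.range k, α (t + 1) * (f t - f (t + 1)) ≤ α k * (R - f k) := by
    intro k
    induction k with
    | zero => intro _; simpa using mul_nonneg hα0 (sub_nonneg.2 (hfR 0 n.zero_le))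
    | succ k ih =>
      intro hk
      rw [Finset.sum_range_succ]
      have h1 := ih (by omega)
      have h2 := mul_le_mul_of_nonneg_right (hα k (by omega)) (sub_nonneg.2 (hfR k (by omega)))
      linarith
  have hαn : ∀ k ≤ n, 0 ≤ α k := by
    intro k
    induction k with
    | zero => intro _; exact hα0
    | succ k ih => intro hk; exact (ih (by omega)).trans (hα k (by omega))
  have := mul_nonneg (hαn n le_rfl) (hf0 n le_rfl)
  linarith [key n le_rfl]

theorem sum_mul_le_sqrt_mul_sqrt (p δ : ℕ → ℝ) (n : ℕ) :
    ∑ t ∈ Finset.range n, p t * δ t ≤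
      √(∑ t ∈ Finset.range n, p t ^ 2) * √(∑ t ∈ Finset.range n, δ t ^ 2) :=
  Real.sum_mul_le_sqrt_mul_sqrt _ _ _

/-- The adaptive step sizes turn the one-step descent inequality into a bound on the sum of the
squared normalised steps. -/
theorem sum_sq_le_of_adaptive {n : ℕ} {p q δ α f : ℕ → ℝ} {R L D' : ℝ} (hD' : 1 ≤ D')
    (hL : 0 ≤ L) (hR : 0 ≤ R) (hp0 : ∀ t < n, 0 ≤ p t) (hpq : ∀ t < n, p t ≤ q t)
    (hqp : ∀ t < n, q t ≤ D' * p t)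
    (hα : ∀ t ≤ n, α t = √(max (∑ s ∈ Finset.range t, q s ^ 2) 1))
    (hf0 : ∀ t ≤ n, 0 ≤ f t) (hfR : ∀ t ≤ n, f t ≤ R)
    (hstep : ∀ t < n, α (t + 1) * (f (t + 1) - f t) / D' ≤
      p t * δ t - p t ^ 2 + L / 2 * D' * (p t ^ 2 / α (t + 1))) :
    ∑ t ∈ Finset.range n, p t ^ 2 ≤
      2 * R + 3 * R ^ 2 + 3 * L ^ 2 * D' ^ 2 + 3 * ∑ t ∈ Finset.range n, δ t ^ 2 := by
  have hmono : ∀ t < n, α t ≤ α (t + 1) := by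
    intro t ht
    rw [hα t ht.le, hα (t + 1) ht, Finset.sum_range_succ]
    apply Real.sqrt_le_sqrt
    exact max_le_max (le_add_of_nonneg_right (sq_nonneg _)) le_rfl
  set S := ∑ t ∈ Finset.range n, p t ^ 2 with hS
  set Δ := ∑ t ∈ Finset.range n, δ t ^ 2 with hΔ
  have hS0 : 0 ≤ S := Finset.sum_nonneg fun _ _ => sq_nonneg _
  have hΔ0 : 0 ≤ Δ := Finset.sum_nonneg fun _ _ => sq_nonneg _
  have hsum := Finset.sum_le_sum fun t ht => hstep t (Finset.mem_range.1 ht)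
  rw [Finset.sum_add_distrib, Finset.sum_sub_distrib, ← Finset.mul_sum, ← Finset.sum_div] at hsum
  have htel := sum_mul_sub_le α f (R := R) n (by rw [hα 0 n.zero_le]; positivity) hmono hf0 hfR
  have htel' : ∑ t ∈ Finset.range n, α (t + 1) * (f (t + 1) - f t) =
      -∑ t ∈ Finset.range n, α (t + 1) * (f t - f (t + 1)) := by
    rw [← Finset.sum_neg_distrib]
    exact Finset.sum_congr rfl fun _ _ => by ring
  -- The final weight is controlled by the very sum to be bounded, since `q ≤ D' * p`.
  have hαn : α n ≤ 1 + D' * √S := by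
    rw [hα n le_rfl]
    have h1 : ∑ t ∈ Finset.range n, q t ^ 2 ≤ D' ^ 2 * S := by
      rw [hS, Finset.mul_sum]
      refine Finset.sum_le_sum fun t ht => ?_
      rw [Finset.mem_range] at ht
      rw [← mul_pow]
      exact pow_le_pow_left₀ ((hp0 t ht).trans (hpq t ht)) (hqp t ht) 2
    rw [Real.sqrt_le_left (by positivity)]
    have h2 : (0 : ℝ) ≤ D' * √S := by positivity
    refine max_le ?_ (by nlinarith)
    have h3 : (D' * √S) ^ 2 = D' ^ 2 * S := by rw [mul_pow, Real.sq_sqrt hS0]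
    nlinarith
  have hdiv : ∑ t ∈ Finset.range n, p t ^ 2 / α (t + 1) ≤ 2 * √S := by
    refine (Finset.sum_le_sum fun t ht => ?_).trans
      (sum_div_sqrt_sum_le (fun t => p t ^ 2) (fun t => sq_nonneg _) n)
    have hle : √(∑ s ∈ Finset.range (t + 1), p s ^ 2) ≤ α (t + 1) := by
      rw [hα (t + 1) (by simpa using ht)]
      apply Real.sqrt_le_sqrt
      refine le_max_of_le_left (Finset.sum_le_sum fun s hs => ?_)
      rw [Finset.mem_range] at ht hs
      exact pow_le_pow_left₀ (hp0 s (by omega)) (hpq s (by omega)) 2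
    rcases (Real.sqrt_nonneg (∑ s ∈ Finset.range (t + 1), p s ^ 2)).eq_or_lt with h0 | h0
    · have h1 := (Real.sqrt_eq_zero (Finset.sum_nonneg fun _ _ => sq_nonneg _)).1 h0.symm
      rw [Finset.sum_eq_zero_iff_of_nonneg fun _ _ => sq_nonneg _] at h1
      rw [h1 t (by simp)]
      simp
    · exact div_le_div_of_nonneg_left (sq_nonneg _) h0 hle
  have hcs := sum_mul_le_sqrt_mul_sqrt p δ n
  have hD0 : 0 < D' := by linarith
  have h1 : -(α n * R) / D' ≤ (∑ t ∈ Finset.range n, α (t + 1) * (f (t + 1) - f t)) / D' := by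
    gcongr
    linarith
  have h2 : α n * R / D' ≤ R + R * √S := by
    rw [div_le_iff₀ hD0]
    have := Real.sqrt_nonneg S
    nlinarith [mul_le_mul_of_nonneg_right hαn hR]
  have h3 : L / 2 * D' * ∑ t ∈ Finset.range n, p t ^ 2 / α (t + 1) ≤ L / 2 * D' * (2 * √S) :=
    mul_le_mul_of_nonneg_left hdiv (by positivity)
  rw [neg_div] at h1
  -- With `b = R + √Δ + L * D'` this reads `S ≤ R + b√S`. As `b√S ≤ (S + b²)/2`, it gives `S ≤ 2R +
  -- b²`, and `b²` is at most three times the sum of the squares.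
  have h4 : S ≤ R + R * √S + √S * √Δ + L * D' * √S := by linarith
  have e1 := Real.sq_sqrt hS0
  have e2 := Real.sq_sqrt hΔ0
  nlinarith [sq_nonneg (√S - (R + √Δ + L * D')), sq_nonneg (R - √Δ), sq_nonneg (R - L * D'),
    sq_nonneg (√Δ - L * D')]

end Deterministic

/-! ### Deterministic analysis of one run. -/

section Run

variable {d : ℕ} {Ξ : Type*} {N : ℕ} {K : Set (Vec d)} {r : Vec d → ℝ}
  {l : Vec d → Ξ → ℝ} {ν : ℝ} {T : ℕ} {x₁ : Vec d} {ξ : ℕ → Fin N → Ξ} {u : ℕ → Fin N → Vec d}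
  {x g v : ℕ → Vec d} {lam α : ℕ → ℝ}

theorem IsZOAdaExpGradPlusRun.one_le_alpha
    (h : IsZOAdaExpGradPlusRun K r l ν T x₁ ξ u x g v lam α) {t : ℕ}
    (ht : t ∈ Finset.Icc 1 (T + 1)) : 1 ≤ α t := by
  rw [h.alpha_eq t ht, Real.one_le_sqrt]
  exact le_max_right _ _

theorem IsZOAdaExpGradPlusRun.alpha_le_succ
    (h : IsZOAdaExpGradPlusRun K r l ν T x₁ ξ u x g v lam α) {t : ℕ}
    (ht : t ∈ Finset.Icc 1 T) : α t ≤ α (t + 1) := by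
  rw [Finset.mem_Icc] at ht
  rw [h.alpha_eq t (Finset.mem_Icc.2 ⟨ht.1, by omega⟩),
    h.alpha_eq (t + 1) (Finset.mem_Icc.2 ⟨by omega, by omega⟩), Finset.sum_Ico_succ_top ht.1]
  apply Real.sqrt_le_sqrt
  exact max_le_max (le_add_of_nonneg_right (by positivity)) le_rfl

theorem IsZOAdaExpGradPlusRun.mem (h : IsZOAdaExpGradPlusRun K r l ν T x₁ ξ u x g v lam α)
    (hK : Convex ℝ K) (hx₁ : x₁ ∈ K)
    (hprox : ∀ x ∈ K, ∀ (g : Vec d) (η : ℝ), mirrorProx K r symEntropy x g η ∈ K) {t : ℕ}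
    (ht : t ∈ Finset.Icc 1 (T + 1)) : x t ∈ K := by
  rw [Finset.mem_Icc] at ht
  obtain ⟨h1, h2⟩ := ht
  induction t, h1 using Nat.le_induction with
  | base => rw [h.init]; exact hx₁
  | succ t h1 ih =>
    have htm : t ∈ Finset.Icc 1 T := Finset.mem_Icc.2 ⟨h1, by omega⟩
    have hx := ih (by omega)
    have hle := h.alpha_le_succ htm
    have h0 := h.one_le_alpha (t := t) (Finset.mem_Icc.2 ⟨h1, by omega⟩)
    have h3 : α t / α (t + 1) ≤ 1 := div_le_one_of_le₀ hle (by linarith)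
    rw [h.update t htm]
    refine hK hx ?_ (sub_nonneg.2 h3) (div_nonneg (by linarith) (by linarith)) (by ring)
    rw [h.mirror_step t htm]
    exact hprox _ hx _ _

/-- Pathwise bound on the generalised gradients at the true gradients of the smooth part `F` along
a run, in terms of the errors of the gradient estimates. -/
theorem IsZOAdaExpGradPlusRun.sum_sq_gradMap_le
    (h : IsZOAdaExpGradPlusRun K r l ν T x₁ ξ u x g v lam α) (hd : 0 < d)
    (hKc : IsClosed K) (hK : Convex ℝ K) (hr : ConvexOn ℝ Set.univ r) (hx₁ : x₁ ∈ K)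
    {D R L : ℝ} (hD : 0 ≤ D) (hKD : ∀ x ∈ K, l1Norm x ≤ D) (hR0 : 0 ≤ R) (hL : 0 ≤ L)
    {F : Vec d → ℝ} {F' : Vec d → Vec d} (hR : ∀ x ∈ K, F x + r x ∈ Set.Icc 0 R)
    (hF : ∀ x y, F y - F x - inner ℝ (F' x) (y - x) ≤ L / 2 * ‖y - x‖ ^ 2) :
    ∑ t ∈ Finset.range T, (α (t + 1) / (D + 1) * l1Norm (x (t + 1) -
      mirrorProx K r symEntropy (x (t + 1)) (F' (x (t + 1))) (α (t + 1)))) ^ 2 ≤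
      4 * R + 6 * R ^ 2 + 6 * L ^ 2 * (D + 1) ^ 2 +
        8 * ∑ t ∈ Finset.range T, supNorm (g (t + 1) - F' (x (t + 1))) ^ 2 := by
  have hspec : ∀ x ∈ K, ∀ (g : Vec d) (η : ℝ),
      IsMirrorProx K r symEntropy x g η (mirrorProx K r symEntropy x g η) := fun x hx =>
    isMirrorProx_mirrorProx hd hKc (continuous_of_convexOn_univ hr) hKD hx
  have hxK : ∀ t ≤ T, x (t + 1) ∈ K := fun t ht =>
    h.mem hK hx₁ (fun x hx g η => (hspec x hx g η).1) (Finset.mem_Icc.2 ⟨by omega, by omega⟩)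
  have hIcc : ∀ t < T, t + 1 ∈ Finset.Icc 1 T := fun t ht => Finset.mem_Icc.2 ⟨by omega, by omega⟩
  have hα1 : ∀ t ≤ T, 1 ≤ α (t + 1) := fun t ht =>
    h.one_le_alpha (Finset.mem_Icc.2 ⟨by omega, by omega⟩)
  have hv : ∀ t < T, IsMirrorProx K r symEntropy (x (t + 1)) (g (t + 1)) (α (t + 1)) (v (t + 1)) :=
    fun t ht => by
      rw [h.mirror_step _ (hIcc t ht)]
      exact hspec _ (hxK t ht.le) _ _
  -- This compares the observable steps that define `α` with those normalised by the unknown `D +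
  -- 1`.
  have hlam : ∀ t < T, 1 / (D + 1) ≤ lam (t + 1) ∧ lam (t + 1) ≤ 1 := by
    intro t ht
    have h0 := l1Norm_nonneg (x (t + 1))
    have hm0 : 0 ≤ max (l1Norm (x (t + 1))) (l1Norm (v (t + 1))) := le_max_of_le_left h0
    have hmD : max (l1Norm (x (t + 1))) (l1Norm (v (t + 1))) ≤ D :=
      max_le (hKD _ (hxK t ht.le)) (hKD _ (hv t ht).1)
    rw [h.lam_eq _ (hIcc t ht)]
    constructor
    · gcongr
    · rw [div_le_one (by linarith)]
      linarith
  set n : ℕ → ℝ := fun t => l1Norm (v (t + 1) - x (t + 1)) with hn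
  have hn0 : ∀ t, 0 ≤ n t := fun t => l1Norm_nonneg _
  -- The run counts from `1` and the scalar lemma from `0`, hence the shift in every sequence.
  have hbound := sum_sq_le_of_adaptive (n := T) (p := fun t => α (t + 1) / (D + 1) * n t)
    (q := fun t => lam (t + 1) * α (t + 1) * n t) (α := fun t => α (t + 1))
    (δ := fun t => supNorm (g (t + 1) - F' (x (t + 1)))) (f := fun t => F (x (t + 1)) + r (x (t + 1)))
    (R := R) (L := L) (D' := D + 1) (by linarith) hL hR0 ?_ ?_ ?_ ?_ ?_ ?_ ?_
  -- The gradient map at the true gradient is at most step plus error. Squaring as `2p² + 2δ²`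
  -- doubles the constants of `hbound` and makes the error factor `2 * 3 + 2 = 8`.
  · have hG : ∀ t < T, α (t + 1) / (D + 1) * l1Norm (x (t + 1) -
        mirrorProx K r symEntropy (x (t + 1)) (F' (x (t + 1))) (α (t + 1))) ≤
        α (t + 1) / (D + 1) * n t + supNorm (g (t + 1) - F' (x (t + 1))) := by
      intro t ht
      have h1 := (hv t ht).lipschitz hd hK hr hKD (by linarith [hα1 t ht.le])
        (hspec _ (hxK t ht.le) (F' (x (t + 1))) (α (t + 1)))
      refine le_trans ?_ (add_le_add_right h1 _)
      rw [← mul_add]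
      have := hα1 t ht.le
      refine mul_le_mul_of_nonneg_left ?_ (by positivity)
      simp only [hn]
      rw [l1Norm_sub_comm (v (t + 1))]
      exact l1Norm_sub_le _ _ _
    have hsq : ∀ t ∈ Finset.range T, (α (t + 1) / (D + 1) * l1Norm (x (t + 1) -
        mirrorProx K r symEntropy (x (t + 1)) (F' (x (t + 1))) (α (t + 1)))) ^ 2 ≤
        2 * (α (t + 1) / (D + 1) * n t) ^ 2 + 2 * supNorm (g (t + 1) - F' (x (t + 1))) ^ 2 := by
      intro t ht
      rw [Finset.mem_range] at ht
      have h1 := hG t ht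
      have h2 := hα1 t ht.le
      have h3 : 0 ≤ α (t + 1) / (D + 1) * l1Norm (x (t + 1) -
        mirrorProx K r symEntropy (x (t + 1)) (F' (x (t + 1))) (α (t + 1))) :=
        mul_nonneg (by positivity) (l1Norm_nonneg _)
      refine (pow_le_pow_left₀ h3 h1 2).trans ?_
      nlinarith [sq_nonneg (α (t + 1) / (D + 1) * n t - supNorm (g (t + 1) - F' (x (t + 1))))]
    refine (Finset.sum_le_sum hsq).trans ?_
    rw [Finset.sum_add_distrib, ← Finset.mul_sum, ← Finset.mul_sum]
    linarith
  · intro t ht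
    have := hα1 t ht.le
    have := hn0 t
    positivity
  · intro t ht
    have h1 := hα1 t ht.le
    have h2 := hn0 t
    have h3 := (hlam t ht).1
    have : α (t + 1) / (D + 1) * n t = 1 / (D + 1) * α (t + 1) * n t := by ring
    rw [this]
    gcongr
  · intro t ht
    have h1 := hα1 t ht.le
    have h2 := hn0 t
    have h3 := (hlam t ht).2
    have : (D + 1) * (α (t + 1) / (D + 1) * n t) = 1 * α (t + 1) * n t := by
      field_simp
    rw [this]
    gcongr
  · intro t ht
    have h1 := h.alpha_eq (t + 1) (Finset.mem_Icc.2 ⟨by omega, by omega⟩)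
    rw [Finset.sum_Ico_eq_sum_range] at h1
    simp only [h1, add_tsub_cancel_right, mul_pow, hn, add_comm 1]
  · exact fun t ht => (hR _ (hxK t ht)).1
  · exact fun t ht => (hR _ (hxK t ht)).2
  · intro t ht
    have hα0 := hα1 t ht.le
    have hα0' := hα1 (t + 1) ht
    have hdesc := (hv t ht).descent hd hK hr (by linarith) (hxK t ht.le) (hKD _ (hxK t ht.le))
      (hKD _ (hv t ht).1)
    have hup := h.update _ (hIcc t ht)
    have hle := h.alpha_le_succ (hIcc t ht)
    simp only [hn]
    set a := α (t + 1)
    set b := α (t + 1 + 1)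
    set X := x (t + 1)
    set W := v (t + 1)
    set m := l1Norm (W - X) with hm
    set γ := a / b with hγ
    have hγ0 : 0 ≤ γ := by positivity
    have hγ1 : γ ≤ 1 := div_le_one_of_le₀ hle (by linarith)
    have hdiff : x (t + 1 + 1) - X = γ • (W - X) := by rw [hup]; module
    have h1 := hF X (x (t + 1 + 1))
    rw [hdiff, inner_smul_right, norm_smul, Real.norm_of_nonneg hγ0] at h1
    have h2 : r (x (t + 1 + 1)) ≤ (1 - γ) * r X + γ * r W := by
      rw [hup]
      exact hr.2 (Set.mem_univ _) (Set.mem_univ _) (by linarith) hγ0 (by ring)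
    have h3 := neg_abs_le (inner ℝ (g (t + 1) - F' X) (W - X))
    have h4 := abs_inner_le_supNorm_mul_l1Norm (g (t + 1) - F' X) (W - X)
    rw [inner_sub_left] at h3 h4
    set δ := supNorm (g (t + 1) - F' X)
    have h5 : (γ * ‖W - X‖) ^ 2 ≤ (γ * m) ^ 2 := by
      have := norm_le_l1Norm (W - X)
      gcongr
    have h6 : inner ℝ (F' X) (W - X) + (r W - r X) ≤ δ * m - a * (m ^ 2 / (D + 1)) := by linarith
    -- Smoothness of `F` along the short step `γ • (W - X)`, convexity of `r`, and descent of the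
    -- full step. Multiplying by `b / (D + 1)` cancels one factor of `γ = a / b`.
    have h7 : F (x (t + 1 + 1)) + r (x (t + 1 + 1)) - (F X + r X) ≤
        γ * (δ * m - a * (m ^ 2 / (D + 1))) + L / 2 * (γ * m) ^ 2 := by
      nlinarith [mul_le_mul_of_nonneg_left h6 hγ0, mul_le_mul_of_nonneg_left h5 hL]
    rw [div_le_iff₀ (by positivity)]
    refine (mul_le_mul_of_nonneg_left h7 (by linarith)).trans (le_of_eq ?_)
    rw [hγ]
    field_simp

end Run

/-! ### Uniform smoothness of `ℓ_{2k}` and the choice of exponent. -/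

section TwoPoint

/-- From `i` to `i + 1` the ratio of the left side to `k.choose i` grows by `(2k - 2i - 1)/(2i + 1)
≤ 2k - 1`. -/
theorem choose_two_mul_le (k i : ℕ) : (2 * k).choose (2 * i) ≤ k.choose i * (2 * k - 1) ^ i := by
  rcases le_or_gt i k with hik | hik
  swap
  · rw [Nat.choose_eq_zero_of_lt (by omega)]
    exact Nat.zero_le _
  induction i with
  | zero => simp
  | succ i ih =>
    have ih := ih (by omega)
    obtain ⟨j, rfl⟩ : ∃ j, k = i + 1 + j := ⟨k - (i + 1), by omega⟩
    have h1 := Nat.choose_succ_right_eq (2 * (i + 1 + j)) (2 * i)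
    have h2 := Nat.choose_succ_right_eq (2 * (i + 1 + j)) (2 * i + 1)
    have h3 := Nat.choose_succ_right_eq (i + 1 + j) i
    rw [show 2 * (i + 1 + j) - 2 * i = 2 * j + 2 by omega] at h1
    rw [show 2 * (i + 1 + j) - (2 * i + 1) = 2 * j + 1 by omega] at h2
    rw [show (i + 1 + j) - i = j + 1 by omega] at h3
    rw [show 2 * (i + 1 + j) - 1 = 2 * i + 2 * j + 1 by omega] at ih ⊢
    rw [show 2 * (i + 1) = 2 * i + 1 + 1 by ring]
    set A := (2 * (i + 1 + j)).choose (2 * i)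
    set B := (2 * (i + 1 + j)).choose (2 * i + 1)
    set C := (2 * (i + 1 + j)).choose (2 * i + 1 + 1)
    set E := (i + 1 + j).choose i
    set H := (i + 1 + j).choose (i + 1)
    set q := 2 * i + 2 * j + 1 with hq
    have h4 : C * ((2 * i + 1) * (i + 1)) = A * ((j + 1) * (2 * j + 1)) := by nlinarith
    have h5 : A * ((j + 1) * (2 * j + 1)) ≤ E * q ^ i * ((j + 1) * q) :=
      Nat.mul_le_mul ih (Nat.mul_le_mul le_rfl (by omega))
    have h6 : E * q ^ i * ((j + 1) * q) = H * q ^ (i + 1) * (i + 1) := by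
      rw [pow_succ]
      calc E * q ^ i * ((j + 1) * q) = (E * (j + 1)) * (q ^ i * q) := by ring
        _ = (H * (i + 1)) * (q ^ i * q) := by rw [h3]
        _ = _ := by ring
    have h7 : C * (i + 1) ≤ C * ((2 * i + 1) * (i + 1)) :=
      Nat.mul_le_mul le_rfl (by nlinarith)
    exact Nat.le_of_mul_le_mul_right (h7.trans (h4.le.trans (h5.trans h6.le))) (Nat.succ_pos i)

theorem sum_range_eq_sum_even (f : ℕ → ℝ) (hf : ∀ i, f (2 * i + 1) = 0) (k : ℕ) :
    ∑ j ∈ Finset.range (2 * k + 1), f j = ∑ i ∈ Finset.range (k + 1), f (2 * i) := by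
  induction k with
  | zero => simp
  | succ k ih =>
    rw [show 2 * (k + 1) + 1 = 2 * k + 1 + 1 + 1 by ring, Finset.sum_range_succ,
      Finset.sum_range_succ, ih, hf, Finset.sum_range_succ _ (k + 1)]
    simp [mul_add]

/-- The two-point inequality for even exponents. -/
theorem add_pow_add_sub_pow_le (k : ℕ) (a b : ℝ) :
    (a + b) ^ (2 * k) + (a - b) ^ (2 * k) ≤
      2 * (a ^ 2 + ((2 * k - 1 : ℕ) : ℝ) * b ^ 2) ^ k := by
  have h1 : (a + b) ^ (2 * k) + (a - b) ^ (2 * k) = ∑ j ∈ Finset.range (2 * k + 1),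
      (1 + (-1) ^ j) * (b ^ j * a ^ (2 * k - j) * ((2 * k).choose j : ℝ)) := by
    rw [add_comm a b, sub_eq_neg_add, add_pow, add_pow, ← Finset.sum_add_distrib]
    refine Finset.sum_congr rfl fun j _ => ?_
    rw [neg_pow b]
    ring
  -- Odd powers of `b` cancel, and the even ones are compared coefficient by coefficient with the
  -- expansion on the right.
  rw [h1, sum_range_eq_sum_even _ (by intro i; simp [pow_succ, pow_mul]), add_comm (a ^ 2), add_pow,
    Finset.mul_sum]
  refine Finset.sum_le_sum fun i hi => ?_
  have hi' : i ≤ k := by simpa [Nat.lt_succ_iff] using hi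
  have h2 : ((2 * k).choose (2 * i) : ℝ) ≤ (k.choose i : ℝ) * ((2 * k - 1 : ℕ) : ℝ) ^ i := by
    exact_mod_cast choose_two_mul_le k i
  have h3 : a ^ (2 * k - 2 * i) = (a ^ 2) ^ (k - i) := by
    rw [← pow_mul, Nat.mul_sub]
  have h4 : ((-1 : ℝ)) ^ (2 * i) = 1 := by simp [pow_mul]
  rw [h3, h4, pow_mul b, mul_pow]
  have h5 : 0 ≤ (b ^ 2) ^ i * (a ^ 2) ^ (k - i) := by positivity
  nlinarith [mul_le_mul_of_nonneg_left h2 h5]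

/-- A norm is `2`-uniformly smooth with constant `c`. -/
def TwoSmooth (E : Type*) [NormedAddCommGroup E] (c : ℝ) : Prop :=
  ∀ x y : E, ‖x + y‖ ^ 2 + ‖x - y‖ ^ 2 ≤ 2 * (‖x‖ ^ 2 + c * ‖y‖ ^ 2)

/-- The squared `ℓ_{2k}` norm is the `ℓ_k` norm of the vector of squares, so Minkowski's inequality
with exponent `k` applies to it. -/
theorem norm_pow_two_mul {d k : ℕ} (hk : 1 ≤ k) [Fact (1 ≤ ((2 * k : ℕ) : ENNReal))]
    (x : PiLp ((2 * k : ℕ) : ENNReal) (fun _ : Fin d => ℝ)) :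
    ‖x‖ ^ 2 = (∑ i, (x i ^ 2) ^ (k : ℝ)) ^ (1 / (k : ℝ)) := by
  have hk0 : (0 : ℝ) < k := by exact_mod_cast hk
  have h0 : 0 < (((2 * k : ℕ) : ENNReal)).toReal := by
    rw [ENNReal.toReal_natCast]
    push_cast
    positivity
  rw [PiLp.norm_eq_sum h0, ENNReal.toReal_natCast]
  have h1 : ∀ i, ‖x i‖ ^ ((2 * k : ℕ) : ℝ) = (x i ^ 2) ^ (k : ℝ) := by
    intro i
    rw [Real.rpow_natCast, Real.rpow_natCast, pow_mul, Real.norm_eq_abs, sq_abs]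
  simp only [h1]
  have hS : 0 ≤ ∑ i, (x i ^ 2) ^ (k : ℝ) :=
    Finset.sum_nonneg fun i _ => Real.rpow_nonneg (sq_nonneg _) _
  rw [← Real.rpow_natCast, ← Real.rpow_mul hS]
  congr 1
  push_cast
  field_simp

/-- Concavity of `t ↦ t^(1/k)` merges the two norms, the two-point inequality acts coordinatewise,
and Minkowski in `ℓ_k` separates `x` from `y`. -/
theorem twoSmooth_piLp {d k : ℕ} (hk : 1 ≤ k) [Fact (1 ≤ ((2 * k : ℕ) : ENNReal))] :
    TwoSmooth (PiLp ((2 * k : ℕ) : ENNReal) (fun _ : Fin d => ℝ)) ((2 * k - 1 : ℕ) : ℝ) := by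
  intro x y
  have hk0 : (0 : ℝ) < k := by exact_mod_cast hk
  have hk1 : (1 : ℝ) ≤ k := by exact_mod_cast hk
  set c : ℝ := ((2 * k - 1 : ℕ) : ℝ) with hc
  have hc0 : 0 ≤ c := Nat.cast_nonneg _
  simp only [norm_pow_two_mul hk]
  set A := ∑ i, ((x + y) i ^ 2) ^ (k : ℝ) with hA
  set B := ∑ i, ((x - y) i ^ 2) ^ (k : ℝ) with hB
  have hA0 : 0 ≤ A := Finset.sum_nonneg fun i _ => Real.rpow_nonneg (sq_nonneg _) _
  have hB0 : 0 ≤ B := Finset.sum_nonneg fun i _ => Real.rpow_nonneg (sq_nonneg _) _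
  have hy0 : 0 ≤ ∑ i, (y i ^ 2) ^ (k : ℝ) :=
    Finset.sum_nonneg fun i _ => Real.rpow_nonneg (sq_nonneg _) _
  obtain ⟨-, hrpow⟩ := Real.concaveOn_rpow (p := 1 / (k : ℝ)) (by positivity)
    (by rw [div_le_one hk0]; exact hk1)
  have hconc := hrpow hA0 hB0 (a := 1 / 2) (b := 1 / 2) (by norm_num) (by norm_num) (by norm_num)
  simp only [smul_eq_mul] at hconc
  have hAB : 1 / 2 * A + 1 / 2 * B ≤ ∑ i, (x i ^ 2 + c * y i ^ 2) ^ (k : ℝ) := by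
    rw [hA, hB, ← mul_add, ← Finset.sum_add_distrib, Finset.mul_sum]
    refine Finset.sum_le_sum fun i _ => ?_
    have := add_pow_add_sub_pow_le k (x i) (y i)
    simp only [Real.rpow_natCast, ← pow_mul]
    simp only [PiLp.add_apply, PiLp.sub_apply]
    linarith
  have hmono : (1 / 2 * A + 1 / 2 * B) ^ (1 / (k : ℝ)) ≤
      (∑ i, (x i ^ 2 + c * y i ^ 2) ^ (k : ℝ)) ^ (1 / (k : ℝ)) :=
    Real.rpow_le_rpow (by positivity) hAB (by positivity)
  have hmink := Real.Lp_add_le_of_nonneg (s := Finset.univ) (f := fun i => x i ^ 2)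
    (g := fun i => c * y i ^ 2) hk1 (fun i _ => sq_nonneg _) (fun i _ => by positivity)
  have hscale : (∑ i, (c * y i ^ 2) ^ (k : ℝ)) ^ (1 / (k : ℝ)) =
      c * (∑ i, (y i ^ 2) ^ (k : ℝ)) ^ (1 / (k : ℝ)) := by
    have : ∀ i, (c * y i ^ 2) ^ (k : ℝ) = c ^ (k : ℝ) * (y i ^ 2) ^ (k : ℝ) := fun i =>
      Real.mul_rpow hc0 (sq_nonneg _)
    simp only [this]
    rw [← Finset.mul_sum, Real.mul_rpow (Real.rpow_nonneg hc0 _) hy0, ← Real.rpow_mul hc0,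
      mul_one_div_cancel hk0.ne', Real.rpow_one]
  rw [hscale] at hmink
  linarith

/-- For `k = ⌈ln d⌉` the comparison factor `d^(1/k)` is at most `e`, and `2k - 1 ≤ 2 ln d + 1 ≤ 3(2
ln d - 1)` once `ln d ≥ 1`. For `d = 2` this last step fails and `k = 1` is checked numerically. -/
theorem exists_even_exponent {d : ℕ} (hd : 2 ≤ d) : ∃ k : ℕ, 1 ≤ k ∧
    ((2 * k - 1 : ℕ) : ℝ) * (d : ℝ) ^ (1 / (k : ℝ)) ≤
      3 * (Real.exp 1 * (2 * Real.log d - 1)) := by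
  rcases hd.eq_or_lt with rfl | hd
  · refine ⟨1, le_rfl, ?_⟩
    have h1 := Real.exp_one_gt_d9
    have h2 := Real.log_two_gt_d9
    norm_num
    nlinarith
  · have hd3 : (3 : ℝ) ≤ d := by exact_mod_cast hd
    have hlog : 1 ≤ Real.log d := by
      rw [Real.le_log_iff_exp_le (by linarith)]
      have := Real.exp_one_lt_d9
      linarith
    set k := ⌈Real.log d⌉₊ with hk
    have hk1 : 1 ≤ k := Nat.one_le_ceil_iff.2 (by linarith)
    have hk0 : (0 : ℝ) < k := by exact_mod_cast hk1
    refine ⟨k, hk1, ?_⟩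
    have h1 : (d : ℝ) ^ (1 / (k : ℝ)) ≤ Real.exp 1 := by
      rw [Real.rpow_def_of_pos (by linarith), Real.exp_le_exp, mul_one_div,
        div_le_one hk0]
      exact Nat.le_ceil _
    have h2 : ((2 * k - 1 : ℕ) : ℝ) ≤ 2 * Real.log d + 1 := by
      rw [Nat.cast_sub (by omega)]
      push_cast
      have := Nat.ceil_lt_add_one (a := Real.log d) (by linarith)
      linarith
    calc ((2 * k - 1 : ℕ) : ℝ) * (d : ℝ) ^ (1 / (k : ℝ))
        ≤ (2 * Real.log d + 1) * Real.exp 1 := by gcongr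
      _ ≤ 3 * (Real.exp 1 * (2 * Real.log d - 1)) := by
        nlinarith [Real.exp_pos 1]

end TwoPoint

/-! ### Mean squares of independent sums in a `2`-smooth norm. -/

section MeanSquare

variable {E : Type*} [NormedAddCommGroup E] {c B : ℝ}

theorem norm_add_sq_le_two_mul (x y : E) : ‖x + y‖ ^ 2 ≤ 2 * ‖x‖ ^ 2 + 2 * ‖y‖ ^ 2 := by
  have h := pow_le_pow_left₀ (norm_nonneg _) (norm_add_le x y) 2
  nlinarith [sq_nonneg (‖x‖ - ‖y‖)]

theorem integrable_norm_sq_of_bound {α : Type*} [MeasurableSpace α] {μ : Measure α}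
    [IsFiniteMeasure μ] {f : α → E} (hf : AEStronglyMeasurable f μ) (hB : ∀ᵐ a ∂μ, ‖f a‖ ≤ B) :
    Integrable (fun a => ‖f a‖ ^ 2) μ := by
  refine Integrable.of_bound (hf.norm.pow 2) (B ^ 2) ?_
  filter_upwards [hB] with a ha
  rw [Real.norm_of_nonneg (sq_nonneg _)]
  exact pow_le_pow_left₀ (norm_nonneg _) ha 2

variable [NormedSpace ℝ E] [CompleteSpace E] [SecondCountableTopology E] [MeasurableSpace E]
  [BorelSpace E]

/-- Adding an independent centred vector increases the mean square of a `2`-smooth norm at most by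
a multiple of the mean square of the vector. -/
theorem TwoSmooth.integral_norm_add_centered_sq_le (hE : TwoSmooth E c) (hc : 0 ≤ c)
    (μ : Measure E) [IsProbabilityMeasure μ] (hB : ∀ᵐ y ∂μ, ‖y‖ ≤ B) (x : E) :
    ∫ y, ‖x + (y - ∫ z, z ∂μ)‖ ^ 2 ∂μ ≤ ‖x‖ ^ 2 + 4 * c * ∫ y, ‖y‖ ^ 2 ∂μ := by
  have hid : Integrable (fun y : E => y) μ :=
    Integrable.of_bound aestronglyMeasurable_id B hB
  have hB1 : ∀ᵐ p ∂μ.prod μ, ‖p.1‖ ≤ B := Measure.quasiMeasurePreserving_fst.ae hB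
  have hB2 : ∀ᵐ p ∂μ.prod μ, ‖p.2‖ ≤ B := Measure.quasiMeasurePreserving_snd.ae hB
  have hi : ∀ (s : E → E → E), Continuous (fun p : E × E => s p.1 p.2) →
      (∀ a b, ‖s a b‖ ≤ ‖x‖ + ‖a‖ + ‖b‖) →
      Integrable (fun p : E × E => ‖s p.1 p.2‖ ^ 2) (μ.prod μ) := by
    intro s hs hsb
    refine integrable_norm_sq_of_bound (B := ‖x‖ + B + B) hs.aestronglyMeasurable ?_
    filter_upwards [hB1, hB2] with p h1 h2
    linarith [hsb p.1 p.2]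
  have hn : ∀ a b : E, ‖x + (a - b)‖ ≤ ‖x‖ + ‖a‖ + ‖b‖ := fun a b =>
    (norm_add_le _ _).trans (by linarith [norm_sub_le a b])
  have hn' : ∀ a b : E, ‖x + (b - a)‖ ≤ ‖x‖ + ‖a‖ + ‖b‖ := fun a b =>
    (norm_add_le _ _).trans (by linarith [norm_sub_le b a])
  have hi1 := hi (fun a b => x + (a - b)) (by fun_prop) hn
  have hi2 := hi (fun a b => x + (b - a)) (by fun_prop) hn'
  -- Symmetrisation: the mean is replaced by an independent copy, so that the increment and its
  -- negative have the same law and `2`-smoothness applies to the pair.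
  have hjensen : ∀ y : E, ‖x + (y - ∫ z, z ∂μ)‖ ^ 2 ≤ ∫ z, ‖x + (y - z)‖ ^ 2 ∂μ := by
    intro y
    have hsub : Integrable (fun z => y - z) μ := (integrable_const y).sub hid
    have hint : Integrable (fun z => x + (y - z)) μ := (integrable_const x).add hsub
    have hmean : ∫ z, x + (y - z) ∂μ = x + (y - ∫ z, z ∂μ) := by
      rw [integral_add (integrable_const x) hsub,
        integral_sub (integrable_const y) hid]
      simp
    have hconv : ConvexOn ℝ Set.univ fun z : E => ‖z‖ ^ 2 :=
      convexOn_univ_norm.pow (fun _ _ => norm_nonneg _) 2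
    have := hconv.map_integral_le (μ := μ) (f := fun z => x + (y - z))
      (by fun_prop) isClosed_univ (by simp) hint
      (by
        refine integrable_norm_sq_of_bound (B := ‖x‖ + ‖y‖ + B) hint.aestronglyMeasurable ?_
        filter_upwards [hB] with z hz
        linarith [hn y z])
    rwa [hmean] at this
  have hprod : ∫ y, ∫ z, ‖x + (y - z)‖ ^ 2 ∂μ ∂μ = ∫ p, ‖x + (p.1 - p.2)‖ ^ 2 ∂μ.prod μ :=
    (integral_prod _ hi1).symm
  have hswap : ∫ p, ‖x + (p.2 - p.1)‖ ^ 2 ∂μ.prod μ = ∫ p, ‖x + (p.1 - p.2)‖ ^ 2 ∂μ.prod μ :=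
    integral_prod_swap (μ := μ) (ν := μ) (fun p : E × E => ‖x + (p.1 - p.2)‖ ^ 2)
  have hsq1 : Integrable (fun p : E × E => ‖p.1‖ ^ 2) (μ.prod μ) :=
    integrable_norm_sq_of_bound continuous_fst.aestronglyMeasurable hB1
  have hsq2 : Integrable (fun p : E × E => ‖p.2‖ ^ 2) (μ.prod μ) :=
    integrable_norm_sq_of_bound continuous_snd.aestronglyMeasurable hB2
  have hsq12 : Integrable (fun p : E × E => ‖p.1‖ ^ 2 + ‖p.2‖ ^ 2) (μ.prod μ) := hsq1.add hsq2
  have hle : ∫ p, (‖x + (p.1 - p.2)‖ ^ 2 + ‖x + (p.2 - p.1)‖ ^ 2) ∂μ.prod μ ≤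
      ∫ p, (2 * ‖x‖ ^ 2 + 4 * c * (‖p.1‖ ^ 2 + ‖p.2‖ ^ 2)) ∂μ.prod μ := by
    refine integral_mono (hi1.add hi2)
      ((integrable_const _).add (hsq12.const_mul _)) fun p => ?_
    have h1 := hE x (p.1 - p.2)
    have h2 := norm_add_sq_le_two_mul p.1 (-p.2)
    rw [norm_neg, ← sub_eq_add_neg] at h2
    have h3 : x + (p.2 - p.1) = x - (p.1 - p.2) := by abel
    simp only [h3]
    nlinarith [mul_le_mul_of_nonneg_left h2 hc]
  rw [integral_add hi1 hi2, hswap, integral_add (integrable_const _) (hsq12.const_mul _),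
    integral_const_mul (4 * c), integral_add hsq1 hsq2] at hle
  have e1 : ∫ p, ‖p.1‖ ^ 2 ∂μ.prod μ = ∫ y, ‖y‖ ^ 2 ∂μ := by
    have := integral_fun_fst (μ := μ) (ν := μ) (fun y : E => ‖y‖ ^ 2)
    simpa using this
  have e2 : ∫ p, ‖p.2‖ ^ 2 ∂μ.prod μ = ∫ y, ‖y‖ ^ 2 ∂μ := by
    have := integral_fun_snd (μ := μ) (ν := μ) (fun y : E => ‖y‖ ^ 2)
    simpa using this
  rw [e1, e2] at hle
  simp only [integral_const, probReal_univ, one_smul] at hle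
  have hfin : ∫ y, ‖x + (y - ∫ z, z ∂μ)‖ ^ 2 ∂μ ≤ ∫ y, ∫ z, ‖x + (y - z)‖ ^ 2 ∂μ ∂μ := by
    refine integral_mono ?_ hi1.integral_prod_left hjensen
    refine integrable_norm_sq_of_bound (B := ‖x‖ + B + ‖∫ z, z ∂μ‖)
      (by fun_prop : Continuous fun y : E => x + (y - ∫ z, z ∂μ)).aestronglyMeasurable ?_
    filter_upwards [hB] with y hy
    linarith [hn y (∫ z, z ∂μ)]
  rw [hprod] at hfin
  linarith

variable {Ω ι : Type*} [MeasurableSpace Ω] {P : Measure Ω} [IsProbabilityMeasure P]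

/-- Fubini for the product law: a bound with the first variable frozen survives when that variable
is random but independent of the second. -/
theorem integral_comp_le_of_indepFun {α β : Type*} [MeasurableSpace α] [MeasurableSpace β]
    {S : Ω → α} {Y : Ω → β} (hS : Measurable S) (hY : Measurable Y) (h : IndepFun S Y P)
    {F : α → β → ℝ} (hF : Measurable fun p : α × β => F p.1 p.2)
    (hi : Integrable (fun ω => F (S ω) (Y ω)) P) {b : α → ℝ} (hb : Integrable (fun ω => b (S ω)) P)
    (hle : ∀ᵐ ω ∂P, ∫ ω', F (S ω) (Y ω') ∂P ≤ b (S ω)) :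
    ∫ ω, F (S ω) (Y ω) ∂P ≤ ∫ ω, b (S ω) ∂P := by
  have hmap := (indepFun_iff_map_prod_eq_prod_map_map hS.aemeasurable hY.aemeasurable).1 h
  have : IsProbabilityMeasure (P.map S) := Measure.isProbabilityMeasure_map hS.aemeasurable
  have : IsProbabilityMeasure (P.map Y) := Measure.isProbabilityMeasure_map hY.aemeasurable
  have hi' : Integrable (fun p : α × β => F p.1 p.2) ((P.map S).prod (P.map Y)) := by
    rw [← hmap, integrable_map_measure hF.aestronglyMeasurable (hS.prodMk hY).aemeasurable]
    exact hi
  have h1 : ∫ ω, F (S ω) (Y ω) ∂P = ∫ s, ∫ y, F s y ∂(P.map Y) ∂(P.map S) := by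
    rw [← integral_prod _ hi', ← hmap,
      integral_map (hS.prodMk hY).aemeasurable hF.aestronglyMeasurable]
  have h2 : ∀ s, ∫ y, F s y ∂(P.map Y) = ∫ ω', F s (Y ω') ∂P := fun s =>
    integral_map hY.aemeasurable (hF.comp (measurable_const.prodMk measurable_id)).aestronglyMeasurable
  have hi'' := hi'.integral_prod_left
  simp only [h2] at h1 hi''
  rw [h1, integral_map hS.aemeasurable hi''.aestronglyMeasurable]
  refine integral_mono_ae ?_ hb hle
  exact (integrable_map_measure hi''.aestronglyMeasurable hS.aemeasurable).1 hi''

/-- Vectors are added one at a time; the partial sum is independent of the next vector and plays the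
role of the frozen `x`. -/
theorem TwoSmooth.integral_norm_sum_centered_sq_le (hE : TwoSmooth E c) (hc : 0 ≤ c)
    {Y : ι → Ω → E} (hY : ∀ i, Measurable (Y i)) (hind : iIndepFun Y P)
    (hB : ∀ i, ∀ᵐ ω ∂P, ‖Y i ω‖ ≤ B) (s : Finset ι) :
    ∫ ω, ‖∑ i ∈ s, (Y i ω - ∫ ω', Y i ω' ∂P)‖ ^ 2 ∂P ≤ 4 * c * ∑ i ∈ s, ∫ ω, ‖Y i ω‖ ^ 2 ∂P := by
  classical
  induction s using Finset.induction_on with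
  | empty => simp
  | insert a s ha ih =>
    set m : ι → E := fun i => ∫ ω', Y i ω' ∂P with hm
    set S : Ω → E := fun ω => ∑ i ∈ s, (Y i ω - m i) with hS
    have hSm : Measurable S := Finset.measurable_sum s fun i _ => (hY i).sub_const _
    have hX : iIndepFun (fun i ω => Y i ω - m i) P :=
      hind.comp (fun i y => y - m i) fun i => measurable_id.sub_const _
    have hSY : IndepFun S (Y a) P := by
      have h1 := hX.indepFun_finsetSum_of_notMem (fun i => (hY i).sub_const _) ha
      have h2 := h1.comp measurable_id (measurable_id.add_const (m a))
      convert h2 using 1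
      · funext ω
        simp [hS]
      · funext ω
        simp
    have hSB : ∀ᵐ ω ∂P, ‖S ω‖ ≤ ∑ i ∈ s, (B + ‖m i‖) := by
      have : ∀ᵐ ω ∂P, ∀ i ∈ s, ‖Y i ω‖ ≤ B := (Finset.eventually_all s).2 fun i _ => hB i
      filter_upwards [this] with ω hω
      refine (norm_sum_le _ _).trans (Finset.sum_le_sum fun i hi => ?_)
      exact (norm_sub_le _ _).trans (add_le_add_left (hω i hi) _)
    have hSi : Integrable (fun ω => ‖S ω‖ ^ 2) P :=
      integrable_norm_sq_of_bound hSm.aestronglyMeasurable hSB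
    have hmap : ∫ y, y ∂(P.map (Y a)) = m a :=
      integral_map (hY a).aemeasurable aestronglyMeasurable_id
    have : IsProbabilityMeasure (P.map (Y a)) :=
      Measure.isProbabilityMeasure_map (hY a).aemeasurable
    have hmapB : ∀ᵐ y ∂(P.map (Y a)), ‖y‖ ≤ B :=
      (ae_map_iff (hY a).aemeasurable (measurableSet_le measurable_norm measurable_const)).2 (hB a)
    have key := integral_comp_le_of_indepFun (P := P) hSm (hY a) hSY
      (F := fun z y => ‖z + (y - m a)‖ ^ 2)
      (b := fun z => ‖z‖ ^ 2 + 4 * c * ∫ ω, ‖Y a ω‖ ^ 2 ∂P)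
      (by fun_prop) ?_ (hSi.add (integrable_const _))
      (Filter.Eventually.of_forall fun ω => ?_)
    · have e1 : ∀ ω, ∑ i ∈ insert a s, (Y i ω - m i) = S ω + (Y a ω - m a) := fun ω => by
        rw [Finset.sum_insert ha, add_comm]
      have ih' : ∫ ω, ‖S ω‖ ^ 2 ∂P ≤ 4 * c * ∑ i ∈ s, ∫ ω, ‖Y i ω‖ ^ 2 ∂P := ih
      change ∫ ω, ‖∑ i ∈ insert a s, (Y i ω - m i)‖ ^ 2 ∂P ≤ _
      simp only [e1]
      refine key.trans ?_
      rw [integral_add hSi (integrable_const _), Finset.sum_insert ha]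
      simp only [integral_const, probReal_univ, one_smul]
      linarith
    · refine integrable_norm_sq_of_bound (B := ∑ i ∈ s, (B + ‖m i‖) + (B + ‖m a‖))
        (hSm.add ((hY a).sub_const _)).aestronglyMeasurable ?_
      filter_upwards [hSB, hB a] with ω h1 h2
      exact (norm_add_le _ _).trans (add_le_add h1 ((norm_sub_le _ _).trans (by linarith)))
    · have h1 := hE.integral_norm_add_centered_sq_le hc (P.map (Y a)) hmapB (S ω)
      rw [hmap, integral_map (hY a).aemeasurable (by fun_prop),
        integral_map (hY a).aemeasurable (by fun_prop)] at h1
      exact h1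

end MeanSquare

/-! ### Moments of Rademacher vectors. -/

section Rademacher

instance isProbabilityMeasure_rademacher : IsProbabilityMeasure rademacher := by
  constructor
  simp [rademacher, ENNReal.inv_two_add_inv_two]

theorem integral_id_rademacher : ∫ z, z ∂rademacher = 0 := by
  unfold rademacher
  rw [integral_add_measure, integral_smul_measure, integral_smul_measure, integral_dirac,
    integral_dirac]
  · simp
  · exact Integrable.smul_measure (integrable_dirac (by simp)) (by simp)
  · exact Integrable.smul_measure (integrable_dirac (by simp)) (by simp)

theorem ae_abs_rademacher : ∀ᵐ z ∂rademacher, |z| = 1 := by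
  unfold rademacher
  rw [ae_add_measure_iff]
  constructor
  · exact Measure.ae_smul_measure (by rw [ae_dirac_eq]; simp) _
  · exact Measure.ae_smul_measure (by rw [ae_dirac_eq]; simp) _

variable {d : ℕ}

instance isProbabilityMeasure_rademacherVec : IsProbabilityMeasure (rademacherVec d) :=
  Measure.isProbabilityMeasure_map (WithLp.measurable_toLp 2 _).aemeasurable

theorem ae_abs_rademacherVec : ∀ᵐ u ∂rademacherVec d, ∀ i, |u i| = 1 := by
  rw [ae_all_iff]
  intro i
  unfold rademacherVec
  refine (ae_map_iff (WithLp.measurable_toLp 2 _).aemeasurable ?_).2 ?_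
  · exact measurableSet_eq_fun (by fun_prop) measurable_const
  · exact (measurePreserving_eval (fun _ : Fin d => rademacher) i).quasiMeasurePreserving.ae
      ae_abs_rademacher

theorem integral_apply_mul_apply_rademacherVec (i k : Fin d) :
    ∫ u, u i * u k ∂rademacherVec d = if i = k then 1 else 0 := by
  split_ifs with h
  · subst h
    have : ∀ᵐ u ∂rademacherVec d, u i * u i = 1 := by
      filter_upwards [ae_abs_rademacherVec] with u hu
      rw [← abs_mul_abs_self, hu i, one_mul]
    rw [integral_congr_ae this]
    simp
  · unfold rademacherVec
    rw [integral_map (WithLp.measurable_toLp 2 _).aemeasurable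
      (Measurable.aestronglyMeasurable (by fun_prop))]
    simp only
    have hind := (iIndepFun_pi (μ := fun _ : Fin d => rademacher) (X := fun _ z => z)
      (fun _ => aemeasurable_id)).indepFun h
    have h1 := hind.integral_fun_mul_eq_mul_integral (measurable_pi_apply i).aestronglyMeasurable
      (measurable_pi_apply k).aestronglyMeasurable
    have h2 : ∫ z : Fin d → ℝ, z i ∂Measure.pi (fun _ => rademacher) = 0 := by
      have h3 := (measurePreserving_eval (fun _ : Fin d => rademacher) i)
      have h4 := integral_map (μ := Measure.pi fun _ : Fin d => rademacher) h3.measurable.aemeasurable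
        (f := fun z : ℝ => z) aestronglyMeasurable_id
      rw [h3.map_eq, integral_id_rademacher] at h4
      exact h4.symm
    rw [h1, h2, zero_mul]

end Rademacher

/-! ### First and second moments of `⟨h, u⟩ u`. -/

section Noise

variable {d : ℕ} {Ξ : Type*} [MeasurableSpace Ξ] {𝒟 : Measure Ξ}

theorem integrable_mul_apply_mul_apply {h : Ξ → ℝ} (hh : Integrable h 𝒟) (i k : Fin d) :
    Integrable (fun p : Ξ × Vec d => h p.1 * (p.2 i * p.2 k)) (𝒟.prod (rademacherVec d)) := by
  have hu : Integrable (fun u : Vec d => u i * u k) (rademacherVec d) := by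
    refine Integrable.of_bound (Measurable.aestronglyMeasurable (by fun_prop)) 1 ?_
    filter_upwards [ae_abs_rademacherVec] with u hu
    rw [Real.norm_eq_abs, abs_mul, hu i, hu k, one_mul]
  exact hh.mul_prod hu

variable [IsProbabilityMeasure 𝒟]

theorem integral_mul_apply_mul_apply (h : Ξ → ℝ) (i k : Fin d) :
    ∫ p : Ξ × Vec d, h p.1 * (p.2 i * p.2 k) ∂𝒟.prod (rademacherVec d) =
      if i = k then ∫ ξ, h ξ ∂𝒟 else 0 := by
  rw [integral_prod_mul h (fun u : Vec d => u i * u k), integral_apply_mul_apply_rademacherVec]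
  split_ifs <;> simp

/-- `E ⟨h, u⟩ u_i = E h_i` for a Rademacher vector `u` independent of `h`. -/
theorem integral_inner_mul_apply {h : Ξ → Vec d} (hh : Integrable h 𝒟) (i : Fin d) :
    ∫ p : Ξ × Vec d, inner ℝ (h p.1) p.2 * p.2 i ∂𝒟.prod (rademacherVec d) = (∫ ξ, h ξ ∂𝒟) i := by
  have hi : ∀ k, Integrable (fun ξ => h ξ k) 𝒟 := fun k =>
    (EuclideanSpace.proj k : Vec d →L[ℝ] ℝ).integrable_comp hh
  have h1 : ∀ p : Ξ × Vec d, inner ℝ (h p.1) p.2 * p.2 i =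
      ∑ k, h p.1 k * (p.2 k * p.2 i) := fun p => by
    rw [inner_vec, Finset.sum_mul]
    exact Finset.sum_congr rfl fun k _ => by ring
  simp only [h1]
  rw [integral_finsetSum _ fun k _ => integrable_mul_apply_mul_apply (hi k) k i]
  have h2 : ∀ k, ∫ p : Ξ × Vec d, h p.1 k * (p.2 k * p.2 i) ∂𝒟.prod (rademacherVec d) =
      if k = i then ∫ ξ, h ξ k ∂𝒟 else 0 := fun k =>
    integral_mul_apply_mul_apply (fun ξ => h ξ k) k i
  simp only [h2, Finset.sum_ite_eq', Finset.mem_univ, if_true]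
  exact (EuclideanSpace.proj i : Vec d →L[ℝ] ℝ).integral_comp_comm hh

/-- `E ⟨h, u⟩² ≤ G²` for a Rademacher vector `u` independent of `h`, if `‖h‖ ≤ G`. -/
theorem integral_inner_sq_le {h : Ξ → Vec d} (hm : Measurable h) {G : ℝ} (hG : ∀ ξ, ‖h ξ‖ ≤ G) :
    ∫ p : Ξ × Vec d, inner ℝ (h p.1) p.2 ^ 2 ∂𝒟.prod (rademacherVec d) ≤ G ^ 2 := by
  have hi : ∀ i k, Integrable (fun ξ => h ξ i * h ξ k) 𝒟 := fun i k => by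
    refine Integrable.of_bound (Measurable.aestronglyMeasurable (by fun_prop)) (G * G)
      (Filter.Eventually.of_forall fun ξ => ?_)
    have h1 : ∀ j, ‖h ξ j‖ ≤ G := fun j => (PiLp.norm_apply_le _ _).trans (hG ξ)
    rw [norm_mul]
    exact mul_le_mul (h1 i) (h1 k) (norm_nonneg _) ((norm_nonneg _).trans (hG ξ))
  have h1 : ∀ p : Ξ × Vec d, inner ℝ (h p.1) p.2 ^ 2 =
      ∑ i, ∑ k, (h p.1 i * h p.1 k) * (p.2 i * p.2 k) := fun p => by
    rw [inner_vec, sq, Finset.sum_mul_sum]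
    exact Finset.sum_congr rfl fun i _ => Finset.sum_congr rfl fun k _ => by ring
  have h2 : ∀ i k, ∫ p : Ξ × Vec d, (h p.1 i * h p.1 k) * (p.2 i * p.2 k)
      ∂𝒟.prod (rademacherVec d) = if i = k then ∫ ξ, h ξ i * h ξ k ∂𝒟 else 0 := fun i k =>
    integral_mul_apply_mul_apply (fun ξ => h ξ i * h ξ k) i k
  have h3 : ∀ i k, Integrable (fun p : Ξ × Vec d => (h p.1 i * h p.1 k) * (p.2 i * p.2 k))
      (𝒟.prod (rademacherVec d)) := fun i k => integrable_mul_apply_mul_apply (hi i k) i k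
  simp only [h1]
  rw [integral_finsetSum _ fun i _ => integrable_finsetSum _ fun k _ => h3 i k]
  simp_rw [integral_finsetSum _ fun k _ => h3 _ k, h2]
  simp only [Finset.sum_ite_eq, Finset.mem_univ, if_true]
  rw [← integral_finsetSum _ fun i _ => hi i i]
  have h4 : ∀ ξ, ∑ i, h ξ i * h ξ i = ‖h ξ‖ ^ 2 := fun ξ => by
    rw [EuclideanSpace.real_norm_sq_eq]
    exact Finset.sum_congr rfl fun i _ => (sq _).symm
  simp only [h4]
  have := norm_integral_le_of_norm_le_const (μ := 𝒟) (f := fun ξ => ‖h ξ‖ ^ 2) (C := G ^ 2)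
    (Filter.Eventually.of_forall fun ξ => by
      rw [Real.norm_of_nonneg (sq_nonneg _)]
      exact pow_le_pow_left₀ (norm_nonneg _) (hG ξ) 2)
  simp only [probReal_univ, mul_one] at this
  exact (le_abs_self _).trans this

end Noise

/-! ### Transfer of the mean square bound from `ℓ_{2k}` to the sup norm. -/

section SupNormMeanSquare

variable {d : ℕ} {Ω ι : Type*} [MeasurableSpace Ω] {P : Measure Ω} [IsProbabilityMeasure P]

theorem integrable_supNorm_sq {f : Ω → Vec d} (hf : Measurable f) {B : ℝ}
    (hB : ∀ᵐ ω ∂P, supNorm (f ω) ≤ B) : Integrable (fun ω => supNorm (f ω) ^ 2) P := by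
  refine Integrable.of_bound
    ((continuous_supNorm.measurable.comp hf).pow_const 2).aestronglyMeasurable (B ^ 2) ?_
  filter_upwards [hB] with ω hω
  rw [Real.norm_of_nonneg (sq_nonneg _)]
  exact pow_le_pow_left₀ (supNorm_nonneg _) hω 2

/-- The mean square of the `ℓ_∞`-norm of a sum of independent centred vectors. -/
theorem integral_supNorm_sum_centered_sq_le (hd : 2 ≤ d) {Y : ι → Ω → Vec d}
    (hY : ∀ i, Measurable (Y i)) (hind : iIndepFun Y P) {B : ℝ}
    (hB : ∀ i, ∀ᵐ ω ∂P, supNorm (Y i ω) ≤ B) (s : Finset ι) :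
    ∫ ω, supNorm (∑ i ∈ s, (Y i ω - ∫ ω', Y i ω' ∂P)) ^ 2 ∂P ≤
      12 * (Real.exp 1 * (2 * Real.log d - 1)) * ∑ i ∈ s, ∫ ω, supNorm (Y i ω) ^ 2 ∂P := by
  obtain ⟨k, hk, hκ⟩ := exists_even_exponent hd
  have hk0 : (0 : ℝ) < k := by exact_mod_cast hk
  have : Fact (1 ≤ ((2 * k : ℕ) : ENNReal)) := ⟨by exact_mod_cast (by omega : 1 ≤ 2 * k)⟩
  set F := PiLp ((2 * k : ℕ) : ENNReal) (fun _ : Fin d => ℝ)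
  -- The identity on coordinates, renormed to `ℓ_{2k}`, which dominates the sup norm and exceeds it
  -- by at most `d^(1/(2k))`. The final constant `12` is `4 * 3`: symmetrisation times
  -- `exists_even_exponent`.
  set Φ : Vec d ≃L[ℝ] F := (PiLp.continuousLinearEquiv 2 ℝ (fun _ : Fin d => ℝ)).trans
    (PiLp.continuousLinearEquiv ((2 * k : ℕ) : ENNReal) ℝ (fun _ : Fin d => ℝ)).symm with hΦ
  have happ : ∀ x i, Φ x i = x i := fun x i => rfl
  have hlow : ∀ x, supNorm x ≤ ‖Φ x‖ := fun x =>
    (supNorm_le_iff (norm_nonneg _)).2 fun i => by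
      rw [← happ, ← Real.norm_eq_abs]
      exact PiLp.norm_apply_le _ _
  have hup : ∀ x, ‖Φ x‖ ^ 2 ≤ (d : ℝ) ^ (1 / (k : ℝ)) * supNorm x ^ 2 := by
    intro x
    rw [norm_pow_two_mul hk]
    have h1 : ∑ i, (Φ x i ^ 2) ^ (k : ℝ) ≤ d * (supNorm x ^ 2) ^ (k : ℝ) := by
      have : ∀ i ∈ (Finset.univ : Finset (Fin d)), (Φ x i ^ 2) ^ (k : ℝ) ≤
          (supNorm x ^ 2) ^ (k : ℝ) := by
        intro i _
        rw [happ, ← sq_abs (x i)]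
        have := abs_apply_le_supNorm x i
        gcongr
      simpa using Finset.sum_le_sum this
    refine (Real.rpow_le_rpow (Finset.sum_nonneg fun i _ => by positivity) h1
      (by positivity)).trans (le_of_eq ?_)
    rw [Real.mul_rpow (by positivity) (by positivity), ← Real.rpow_mul (sq_nonneg _),
      mul_one_div_cancel hk0.ne', Real.rpow_one]
  have hΦm : Measurable Φ := Φ.continuous.measurable
  have hYm : ∀ i, Measurable fun ω => Φ (Y i ω) := fun i => hΦm.comp (hY i)
  have hind' : iIndepFun (fun i ω => Φ (Y i ω)) P := hind.comp (fun _ => Φ) fun _ => hΦm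
  have hB' : ∀ i, ∀ᵐ ω ∂P, ‖Φ (Y i ω)‖ ≤ √((d : ℝ) ^ (1 / (k : ℝ)) * B ^ 2) := by
    intro i
    filter_upwards [hB i] with ω hω
    refine Real.le_sqrt_of_sq_le ((hup _).trans ?_)
    have := supNorm_nonneg (Y i ω)
    gcongr
  have hmain := (twoSmooth_piLp (d := d) hk).integral_norm_sum_centered_sq_le
    (Nat.cast_nonneg _) hYm hind' hB' s
  have hmean : ∀ i, ∫ ω, Φ (Y i ω) ∂P = Φ (∫ ω, Y i ω ∂P) := fun i => Φ.integral_comp_comm _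
  simp only [hmean, ← map_sub, ← map_sum] at hmain
  have hsumY : ∀ i ∈ s, ∫ ω, ‖Φ (Y i ω)‖ ^ 2 ∂P ≤
      (d : ℝ) ^ (1 / (k : ℝ)) * ∫ ω, supNorm (Y i ω) ^ 2 ∂P := by
    intro i _
    rw [← integral_const_mul]
    exact integral_mono (integrable_norm_sq_of_bound (hYm i).aestronglyMeasurable (hB' i))
      ((integrable_supNorm_sq (hY i) (hB i)).const_mul _) fun ω => hup _
  have hsum := Finset.sum_le_sum hsumY
  rw [← Finset.mul_sum] at hsum
  have hV0 : 0 ≤ ∑ i ∈ s, ∫ ω, supNorm (Y i ω) ^ 2 ∂P :=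
    Finset.sum_nonneg fun i _ => integral_nonneg fun ω => sq_nonneg _
  set Z : Ω → Vec d := fun ω => ∑ i ∈ s, (Y i ω - ∫ ω', Y i ω' ∂P) with hZ
  have hZm : Measurable Z := Finset.measurable_sum s fun i _ => (hY i).sub_const _
  have hZB : ∀ᵐ ω ∂P, supNorm (Z ω) ≤ ∑ i ∈ s, (B + supNorm (∫ ω', Y i ω' ∂P)) := by
    have : ∀ᵐ ω ∂P, ∀ i ∈ s, supNorm (Y i ω) ≤ B := (Finset.eventually_all s).2 fun i _ => hB i
    filter_upwards [this] with ω hω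
    refine (supNorm_le_iff (Finset.sum_nonneg fun i hi => add_nonneg
      ((supNorm_nonneg _).trans (hω i hi)) (supNorm_nonneg _))).2 fun j => ?_
    simp only [hZ, WithLp.ofLp_sum, Finset.sum_apply]
    refine (Finset.abs_sum_le_sum_abs _ _).trans (Finset.sum_le_sum fun i hi => ?_)
    refine (abs_apply_le_supNorm _ j).trans ((supNorm_sub_le _ _).trans ?_)
    exact add_le_add_left (hω i hi) _
  have hZB' : ∀ᵐ ω ∂P, ‖Φ (Z ω)‖ ≤ √((d : ℝ) ^ (1 / (k : ℝ)) *
      (∑ i ∈ s, (B + supNorm (∫ ω', Y i ω' ∂P))) ^ 2) := by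
    filter_upwards [hZB] with ω hω
    refine Real.le_sqrt_of_sq_le ((hup _).trans ?_)
    have := supNorm_nonneg (Z ω)
    gcongr
  calc ∫ ω, supNorm (Z ω) ^ 2 ∂P ≤ ∫ ω, ‖Φ (Z ω)‖ ^ 2 ∂P := by
        refine integral_mono (integrable_supNorm_sq hZm hZB)
          (integrable_norm_sq_of_bound (hΦm.comp hZm).aestronglyMeasurable hZB') fun ω => ?_
        exact pow_le_pow_left₀ (supNorm_nonneg _) (hlow _) 2
    _ ≤ 4 * ((2 * k - 1 : ℕ) : ℝ) * ∑ i ∈ s, ∫ ω, ‖Φ (Y i ω)‖ ^ 2 ∂P := hmain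
    _ ≤ 4 * ((2 * k - 1 : ℕ) : ℝ) * ((d : ℝ) ^ (1 / (k : ℝ)) *
          ∑ i ∈ s, ∫ ω, supNorm (Y i ω) ^ 2 ∂P) := by gcongr
    _ = 4 * (((2 * k - 1 : ℕ) : ℝ) * (d : ℝ) ^ (1 / (k : ℝ))) *
          ∑ i ∈ s, ∫ ω, supNorm (Y i ω) ^ 2 ∂P := by ring
    _ ≤ 4 * (3 * (Real.exp 1 * (2 * Real.log d - 1))) *
          ∑ i ∈ s, ∫ ω, supNorm (Y i ω) ^ 2 ∂P := by gcongr
    _ = _ := by ring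

end SupNormMeanSquare

/-! ### Bias and variance of the two-point estimate. -/

section EstimateError

variable {d : ℕ} {Ξ : Type*} {l : Vec d → Ξ → ℝ} {G L : ℝ}

theorem sum_fin_le_mul {N : ℕ} {f : Fin N → ℝ} {a : ℝ} (h : ∀ j, f j ≤ a) :
    ∑ j, f j ≤ N * a :=
  (Finset.sum_le_card_nsmul _ f a fun j _ => h j).trans_eq (by simp)

theorem two_mul_log_sub_one_pos (hd : 2 ≤ d) : 0 < 2 * Real.log d - 1 := by
  have h1 := Real.log_two_gt_d9
  have h2 : Real.log 2 ≤ Real.log d := Real.log_le_log (by norm_num) (by exact_mod_cast hd)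
  linarith

theorem supNorm_of_abs_eq_one (hd : 0 < d) {z : Vec d} (hz : ∀ i, |z i| = 1) : supNorm z = 1 :=
  le_antisymm ((supNorm_le_iff zero_le_one).2 fun i => (hz i).le)
    ((hz ⟨0, hd⟩).symm.le.trans (abs_apply_le_supNorm z _))

theorem norm_sq_of_abs_eq_one {z : Vec d} (hz : ∀ i, |z i| = 1) : ‖z‖ ^ 2 = d := by
  rw [EuclideanSpace.real_norm_sq_eq]
  have : ∀ i, z i ^ 2 = 1 := fun i => by rw [← sq_abs, hz i, one_pow]
  simp [this]

/-- Pathwise decomposition of the error of the two-point estimate. -/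
theorem supNorm_twoPointEstimate_sub_sq_le (hd : 0 < d) (hs : IsSmoothLoss l G L) {N : ℕ}
    (hN : 0 < N) {ν : ℝ} (hν : 0 < ν) (hL : 0 ≤ L) (x a : Vec d) (ξ : Fin N → Ξ)
    (u : Fin N → Vec d) (hu : ∀ j i, |u j i| = 1) :
    supNorm (twoPointEstimate l ν x ξ u - a) ^ 2 ≤
      2 / (N : ℝ) ^ 2 * supNorm (∑ j, (inner ℝ (gradient (fun z => l z (ξ j)) x) (u j) • u j - a)) ^ 2
        + 2 * (L / 2 * ν * d) ^ 2 := by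
  have hN0 : (0 : ℝ) < N := by exact_mod_cast hN
  set W := ∑ j, (inner ℝ (gradient (fun z => l z (ξ j)) x) (u j) • u j - a) with hW
  -- The Taylor remainder of one difference quotient; `‖u j‖² = d` produces the factor `d`.
  set e : Fin N → ℝ := fun j => (l (x + ν • u j) (ξ j) - l x (ξ j)) / ν -
    inner ℝ (gradient (fun z => l z (ξ j)) x) (u j) with he
  have heb : ∀ j, |e j| ≤ L / 2 * ν * d := by
    intro j
    have h1 := hs.abs_taylor_le (ξ j) x (x + ν • u j)
    rw [add_sub_cancel_left, inner_smul_right, norm_smul, mul_pow, norm_sq_of_abs_eq_one (hu j),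
      Real.norm_of_nonneg hν.le] at h1
    have h2 : e j = (l (x + ν • u j) (ξ j) - l x (ξ j) -
        ν * inner ℝ (gradient (fun z => l z (ξ j)) x) (u j)) / ν := by
      simp only [he]
      field_simp
    rw [h2, abs_div, abs_of_pos hν, div_le_iff₀ hν]
    linarith
  have hdecomp : twoPointEstimate l ν x ξ u - a = (1 / (N : ℝ)) • W +
      (1 / (N : ℝ)) • ∑ j, e j • u j := by
    rw [← smul_add, hW, ← Finset.sum_add_distrib]
    have h1 : ∀ j, inner ℝ (gradient (fun z => l z (ξ j)) x) (u j) • u j - a + e j • u j =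
        (1 / ν) • ((l (x + ν • u j) (ξ j) - l x (ξ j)) • u j) - a := by
      intro j
      simp only [he]
      module
    simp only [h1]
    rw [Finset.sum_sub_distrib, ← Finset.smul_sum, smul_sub, smul_smul]
    simp only [Finset.sum_const, Finset.card_univ, Fintype.card_fin]
    rw [← Nat.cast_smul_eq_nsmul ℝ, smul_smul, one_div_mul_cancel hN0.ne', one_smul,
      twoPointEstimate, one_div_mul_one_div]
  have h1 : supNorm ((1 / (N : ℝ)) • ∑ j, e j • u j) ≤ L / 2 * ν * d := by
    rw [supNorm_smul, abs_of_pos (by positivity), one_div, inv_mul_le_iff₀ hN0]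
    refine (supNorm_le_iff (by positivity)).2 fun i => ?_
    simp only [WithLp.ofLp_sum, Finset.sum_apply, PiLp.smul_apply, smul_eq_mul]
    refine (Finset.abs_sum_le_sum_abs _ _).trans ?_
    have : ∀ j ∈ (Finset.univ : Finset (Fin N)), |e j * u j i| ≤ L / 2 * ν * d := fun j _ => by
      rw [abs_mul, hu, mul_one]
      exact heb j
    simpa using Finset.sum_le_sum this
  rw [hdecomp]
  have h2 := supNorm_add_le ((1 / (N : ℝ)) • W) ((1 / (N : ℝ)) • ∑ j, e j • u j)
  have h3 : 2 / (N : ℝ) ^ 2 * supNorm W ^ 2 = 2 * supNorm ((1 / (N : ℝ)) • W) ^ 2 := by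
    rw [supNorm_smul, abs_of_pos (by positivity)]
    ring
  rw [h3]
  have h4 := supNorm_nonneg ((1 / (N : ℝ)) • ∑ j, e j • u j)
  have h5 := supNorm_nonneg ((1 / (N : ℝ)) • W)
  set A := supNorm ((1 / (N : ℝ)) • W)
  set A' := supNorm ((1 / (N : ℝ)) • ∑ j, e j • u j)
  have h6 := pow_le_pow_left₀ h4 h1 2
  have h7 := pow_le_pow_left₀ (supNorm_nonneg _) h2 2
  nlinarith [sq_nonneg (A - A')]

theorem abs_inner_le_of_abs_eq_one {h z : Vec d} (hh : ‖h‖ ≤ G) (hz : ∀ i, |z i| = 1) :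
    |inner ℝ h z| ≤ G * √d := by
  refine (abs_real_inner_le_norm _ _).trans ?_
  rw [← norm_sq_of_abs_eq_one hz, Real.sqrt_sq (norm_nonneg _)]
  gcongr

theorem smoothing_bias_sq (hd : 0 < d) {T : ℕ} (hT : 1 ≤ T) {ν : ℝ} (hν : ν = 1 / (d * √T)) :
    2 * (L / 2 * ν * d) ^ 2 = L ^ 2 / 2 / T := by
  have hT0 : (0 : ℝ) < T := by exact_mod_cast hT
  have hd0 : (0 : ℝ) < d := by exact_mod_cast hd
  have h1 : L / 2 * ν * d = L / (2 * √T) := by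
    rw [hν]
    field_simp
  rw [h1, div_pow, mul_pow, Real.sq_sqrt hT0.le]
  field_simp

/-- A crude deterministic bound, used only for integrability, where its growth in `d` is harmless.
-/
theorem supNorm_twoPointEstimate_sub_sq_le_const (hd : 0 < d) (hs : IsSmoothLoss l G L) {N : ℕ}
    (hN : 0 < N) (hG : 0 ≤ G) (hL : 0 ≤ L) {T : ℕ} (hT : 1 ≤ T) {ν : ℝ}
    (hν : ν = 1 / (d * √T)) (x : Vec d) {a : Vec d} (ha : ‖a‖ ≤ G) (ξ : Fin N → Ξ)
    (u : Fin N → Vec d) (hu : ∀ j i, |u j i| = 1) :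
    supNorm (twoPointEstimate l ν x ξ u - a) ^ 2 ≤ 2 * (G * √d + G) ^ 2 + L ^ 2 / 2 := by
  have hN0 : (0 : ℝ) < N := by exact_mod_cast hN
  have hT0 : (1 : ℝ) ≤ T := by exact_mod_cast hT
  have hd0 : (0 : ℝ) < d := by exact_mod_cast hd
  have hν0 : 0 < ν := by rw [hν]; positivity
  refine (supNorm_twoPointEstimate_sub_sq_le hd hs hN hν0 hL x a ξ u hu).trans ?_
  rw [smoothing_bias_sq hd hT hν]
  refine add_le_add ?_ (div_le_self (by positivity) hT0)
  have h1 : supNorm (∑ j, (inner ℝ (gradient (fun z => l z (ξ j)) x) (u j) • u j - a)) ≤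
      N * (G * √d + G) := by
    refine (supNorm_le_iff (by positivity)).2 fun i => ?_
    simp only [WithLp.ofLp_sum, Finset.sum_apply]
    refine (Finset.abs_sum_le_sum_abs _ _).trans ?_
    refine sum_fin_le_mul fun j => ?_
    · simp only [PiLp.sub_apply, PiLp.smul_apply, smul_eq_mul]
      refine (abs_sub _ _).trans (add_le_add ?_ ?_)
      · rw [abs_mul, hu, mul_one]
        exact abs_inner_le_of_abs_eq_one (hs.norm_gradient_le hG _ _) (hu j)
      · exact (PiLp.norm_apply_le a i).trans ha
  have h2 := pow_le_pow_left₀ (supNorm_nonneg _) h1 2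
  rw [div_mul_eq_mul_div, div_le_iff₀ (by positivity)]
  nlinarith

variable {Ω : Type*} [MeasurableSpace Ξ] [MeasurableSpace Ω] {P : Measure Ω}
  [IsProbabilityMeasure P] {𝒟 : Measure Ξ} [IsProbabilityMeasure 𝒟]

/-- The mean square error of the mini-batch two-point estimate at a fixed point. -/
theorem integral_supNorm_twoPointEstimate_sub_sq_le (hd : 2 ≤ d) (hs : IsSmoothLoss l G L)
    (hl : IsUnbiasedLoss 𝒟 l) (hG : 0 ≤ G) (hL : 0 ≤ L) {T N : ℕ} (hT : 1 ≤ T)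
    (hN : 2 * T * Real.exp 1 * (2 * Real.log d - 1) ≤ N) {ν : ℝ} (hν : ν = 1 / (d * √T))
    {ξ : Fin N → Ω → Ξ} {u : Fin N → Ω → Vec d} (hξ : ∀ j, Measurable (ξ j))
    (hu : ∀ j, Measurable (u j))
    (hlaw : ∀ j, P.map (fun ω => (ξ j ω, u j ω)) = 𝒟.prod (rademacherVec d))
    (hind : iIndepFun (fun j ω => (ξ j ω, u j ω)) P)
    (hu1 : ∀ᵐ ω ∂P, ∀ j i, |u j ω i| = 1) (x : Vec d) :
    ∫ ω, supNorm (twoPointEstimate l ν x (fun j => ξ j ω) (fun j => u j ω) -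
      gradient (expLoss 𝒟 l) x) ^ 2 ∂P ≤ (12 * G ^ 2 + L ^ 2 / 2) / T := by
  have hd0 : 0 < d := by omega
  have hd0' : (0 : ℝ) < d := by exact_mod_cast hd0
  have hT0 : (0 : ℝ) < T := by exact_mod_cast hT
  have hlog := two_mul_log_sub_one_pos hd
  have hκ : 0 < Real.exp 1 * (2 * Real.log d - 1) := mul_pos (Real.exp_pos 1) hlog
  set κ := Real.exp 1 * (2 * Real.log d - 1) with hκdef
  have hNκ : 2 * T * κ ≤ N := by rw [hκdef, ← mul_assoc]; exact hN
  have hN0 : (0 : ℝ) < N := lt_of_lt_of_le (by positivity) hNκ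
  have hN0' : 0 < N := by exact_mod_cast hN0
  have hν0 : 0 < ν := by rw [hν]; positivity
  set h : Ξ → Vec d := fun ξ => gradient (fun z => l z ξ) x with hh
  have hhm : Measurable h := measurable_gradient hs hl.measurable x
  have hhG : ∀ ξ, ‖h ξ‖ ≤ G := fun ξ => hs.norm_gradient_le hG ξ x
  have hhi : Integrable h 𝒟 := integrable_gradient hG hs hl.measurable x
  set y : Ξ × Vec d → Vec d := fun p => inner ℝ (h p.1) p.2 • p.2 with hy
  have hinner : Measurable fun p : Ξ × Vec d => inner ℝ (h p.1) p.2 :=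
    (hhm.comp measurable_fst).inner measurable_snd
  have hym : Measurable y := hinner.smul measurable_snd
  have hpm : ∀ j, Measurable fun ω => (ξ j ω, u j ω) := fun j => (hξ j).prodMk (hu j)
  set Y : Fin N → Ω → Vec d := fun j ω => y (ξ j ω, u j ω) with hY
  have hYm : ∀ j, Measurable (Y j) := fun j => hym.comp (hpm j)
  have hYind : iIndepFun Y P := hind.comp (fun _ => y) fun _ => hym
  -- A sign vector has sup norm `1`, so the second moment is that of a scalar product and does not
  -- grow with `d`.
  have hYsup : ∀ j, ∀ᵐ ω ∂P, supNorm (Y j ω) = |inner ℝ (h (ξ j ω)) (u j ω)| := by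
    intro j
    filter_upwards [hu1] with ω hω
    simp only [hY, hy]
    rw [supNorm_smul, supNorm_of_abs_eq_one hd0 (hω j), mul_one]
  have hYB : ∀ j, ∀ᵐ ω ∂P, supNorm (Y j ω) ≤ G * √d := by
    intro j
    filter_upwards [hYsup j, hu1] with ω h1 h2
    rw [h1]
    exact abs_inner_le_of_abs_eq_one (hhG _) (h2 j)
  have hYi : ∀ j, Integrable (Y j) P := by
    intro j
    refine Integrable.of_bound (hYm j).aestronglyMeasurable (G * √d * √d) ?_
    filter_upwards [hu1] with ω hω
    simp only [hY, hy, norm_smul, Real.norm_eq_abs]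
    refine mul_le_mul (abs_inner_le_of_abs_eq_one (hhG _) (hω j)) ?_ (norm_nonneg _) (by positivity)
    rw [← norm_sq_of_abs_eq_one (hω j), Real.sqrt_sq (norm_nonneg _)]
  have hYmean : ∀ j, ∫ ω, Y j ω ∂P = gradient (expLoss 𝒟 l) x := by
    intro j
    ext i
    rw [← hl.unbiased, ← integral_inner_mul_apply hhi i, ← hlaw j, integral_map (hpm j).aemeasurable]
    · exact ((EuclideanSpace.proj i : Vec d →L[ℝ] ℝ).integral_comp_comm (hYi j)).symm
    · exact (hinner.mul (by fun_prop)).aestronglyMeasurable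
  have hYsq : ∀ j, ∫ ω, supNorm (Y j ω) ^ 2 ∂P ≤ G ^ 2 := by
    intro j
    refine le_trans (le_of_eq ?_) (integral_inner_sq_le (𝒟 := 𝒟) hhm hhG)
    rw [← hlaw j, integral_map (hpm j).aemeasurable]
    · refine integral_congr_ae ?_
      filter_upwards [hYsup j] with ω hω
      rw [hω, sq_abs]
    · exact (hinner.pow_const 2).aestronglyMeasurable
  have hmain := integral_supNorm_sum_centered_sq_le hd hYm hYind hYB Finset.univ
  simp only [hYmean] at hmain
  have hsum : ∑ j, ∫ ω, supNorm (Y j ω) ^ 2 ∂P ≤ N * G ^ 2 := by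
    simpa using Finset.sum_le_sum fun j (_ : j ∈ (Finset.univ : Finset (Fin N))) => hYsq j
  set W : Ω → Vec d := fun ω => ∑ j, (Y j ω - gradient (expLoss 𝒟 l) x) with hW
  have hWm : Measurable W := Finset.measurable_sum _ fun j _ => (hYm j).sub_const _
  have hWB : ∀ᵐ ω ∂P, supNorm (W ω) ≤ N * (G * √d + G) := by
    filter_upwards [ae_all_iff.2 hYB] with ω hω
    refine (supNorm_le_iff (by positivity)).2 fun i => ?_
    simp only [hW, WithLp.ofLp_sum, Finset.sum_apply]
    refine (Finset.abs_sum_le_sum_abs _ _).trans ?_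
    refine sum_fin_le_mul fun j => ?_
    refine (abs_apply_le_supNorm _ i).trans ((supNorm_sub_le _ _).trans (add_le_add (hω j) ?_))
    exact (supNorm_le_norm _).trans (norm_gradient_expLoss_le hG hs hl x)
  have hWi := integrable_supNorm_sq hWm hWB
  calc ∫ ω, supNorm (twoPointEstimate l ν x (fun j => ξ j ω) (fun j => u j ω) -
        gradient (expLoss 𝒟 l) x) ^ 2 ∂P
      ≤ ∫ ω, (2 / (N : ℝ) ^ 2 * supNorm (W ω) ^ 2 + 2 * (L / 2 * ν * d) ^ 2) ∂P := by
        refine integral_mono_of_nonneg (Filter.Eventually.of_forall fun ω => sq_nonneg _)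
          ((hWi.const_mul _).add (integrable_const _)) ?_
        filter_upwards [hu1] with ω hω
        exact supNorm_twoPointEstimate_sub_sq_le hd0 hs hN0' hν0 hL x _ _ _ hω
    _ = 2 / (N : ℝ) ^ 2 * ∫ ω, supNorm (W ω) ^ 2 ∂P + L ^ 2 / 2 / T := by
        rw [integral_add (hWi.const_mul _) (integrable_const _), integral_const_mul,
          smoothing_bias_sq hd0 hT hν]
        simp
    _ ≤ 2 / (N : ℝ) ^ 2 * (12 * κ * (N * G ^ 2)) + L ^ 2 / 2 / T := by
        gcongr
        exact hmain.trans (by gcongr)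
    _ ≤ 12 * G ^ 2 / T + L ^ 2 / 2 / T := by
        gcongr
        -- The batch size enters here: `2 * κ / N ≤ 1 / T`.
        have h1 : 2 / (N : ℝ) ^ 2 * (12 * κ * (N * G ^ 2)) = 12 * G ^ 2 * (2 * κ) / N := by
          field_simp
        rw [h1, div_le_div_iff₀ hN0 hT0]
        have := mul_le_mul_of_nonneg_left hNκ (by positivity : 0 ≤ 12 * G ^ 2)
        linarith
    _ = (12 * G ^ 2 + L ^ 2 / 2) / T := by ring

end EstimateError

/-! ### Past samples and independence of the current batch. -/

section PastSamples

variable {Ω ι β : Type*} [MeasurableSpace β]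

theorem comap_pi_le [m : MeasurableSpace Ω] {F : ι → Ω → β} (h : ∀ j, Measurable (F j)) :
    MeasurableSpace.comap (fun ω j => F j ω) inferInstance ≤ m :=
  (measurable_pi_lambda _ h).comap_le

/-- The `σ`-algebra generated by the samples drawn before iteration `t`. -/
@[reducible] def pastSamples (S : ℕ × ι → Ω → β) (t : ℕ) :
    MeasurableSpace Ω :=
  ⨆ p ∈ {p : ℕ × ι | p.1 < t}, MeasurableSpace.comap (S p) inferInstance

theorem measurable_pastSamples (S : ℕ × ι → Ω → β) {t : ℕ}
    {p : ℕ × ι} (hp : p.1 < t) : Measurable[pastSamples S t] (S p) := by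
  rw [measurable_iff_comap_le]
  exact le_iSup₂ (f := fun (p : ℕ × ι) (_ : p ∈ {p : ℕ × ι | p.1 < t}) =>
    MeasurableSpace.comap (S p) inferInstance) p hp

theorem pastSamples_mono (S : ℕ × ι → Ω → β) {s t : ℕ}
    (h : s ≤ t) : pastSamples S s ≤ pastSamples S t :=
  biSup_mono fun _ hp => lt_of_lt_of_le hp h

theorem pastSamples_le_comap (S : ℕ × ι → Ω → β) (t : ℕ) :
    pastSamples S t ≤ MeasurableSpace.comap (fun ω p => S p ω) inferInstance := by
  refine iSup₂_le fun p _ => ?_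
  rw [← measurable_iff_comap_le]
  exact (measurable_pi_apply p).comp (comap_measurable fun ω p => S p ω)

variable [MeasurableSpace Ω]

/-- Past and present use disjoint sets of sample indices, so the `σ`-algebras they generate are
independent. -/
theorem indepFun_batch {γ : Type*} [MeasurableSpace γ] {P : Measure Ω}
    {S : ℕ × ι → Ω → β} (hS : ∀ p, Measurable (S p)) (hind : iIndepFun S P) {t : ℕ} {X : Ω → γ}
    (hX : Measurable[pastSamples S t] X) : IndepFun X (fun ω j => S (t, j) ω) P := by
  have h := indep_iSup_of_disjoint (m := fun p => MeasurableSpace.comap (S p) inferInstance)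
    (fun p => (hS p).comap_le) hind (S := {p : ℕ × ι | p.1 < t}) (T := {p : ℕ × ι | p.1 = t})
    (Set.disjoint_left.2 fun p (h1 : p.1 < t) (h2 : p.1 = t) => h1.ne h2)
  rw [IndepFun_iff_Indep]
  refine indep_of_indep_of_le_left (indep_of_indep_of_le_right h ?_) hX.comap_le
  refine comap_pi_le (m := ⨆ p ∈ {p : ℕ × ι | p.1 = t},
    MeasurableSpace.comap (S p) inferInstance) (F := fun j => S (t, j)) fun j => ?_
  rw [measurable_iff_comap_le]
  exact le_iSup₂ (f := fun (p : ℕ × ι) (_ : p ∈ {p : ℕ × ι | p.1 = t}) =>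
    MeasurableSpace.comap (S p) inferInstance) (t, j) rfl

end PastSamples

/-! ### Measurability of the iterates. -/

section RunMeasurability

variable {d : ℕ} {Ξ Ω : Type*} [mΩ : MeasurableSpace Ω] {K : Set (Vec d)}
  {r : Vec d → ℝ} {l : Vec d → Ξ → ℝ} {G L : ℝ}

theorem ContinuousOn.measurable_comp {A B : Type*} [TopologicalSpace A] [MeasurableSpace A]
    [OpensMeasurableSpace A] [TopologicalSpace B] [MeasurableSpace B] [BorelSpace B] {f : A → B}
    {s : Set A} (hf : ContinuousOn f s) {q : Ω → A} (hq : Measurable q) (hmem : ∀ ω, q ω ∈ s) :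
    Measurable fun ω => f (q ω) :=
  hf.domRestrict.measurable.comp (hq.subtype_mk (h := hmem))

theorem measurable_mirrorProx (hd : 0 < d) (hKc : IsClosed K) (hK : Convex ℝ K)
    (hr : ConvexOn ℝ Set.univ r) {D : ℝ} (hKD : ∀ x ∈ K, l1Norm x ≤ D) {x g : Ω → Vec d}
    {α : Ω → ℝ} (hx : Measurable x) (hg : Measurable g) (hα : Measurable α) (hxK : ∀ ω, x ω ∈ K)
    (hα0 : ∀ ω, 0 < α ω) : Measurable fun ω => mirrorProx K r symEntropy (x ω) (g ω) (α ω) := by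
  have hmem : ∀ ω, (x ω, g ω, α ω) ∈ K ×ˢ (Set.univ ×ˢ Set.Ioi (0 : ℝ)) := fun ω =>
    Set.mem_prod.2 ⟨hxK ω, Set.mem_prod.2 ⟨Set.mem_univ _, hα0 ω⟩⟩
  have h := (continuousOn_mirrorProx hd hKc hK hr hKD).measurable_comp
    (hx.prodMk (hg.prodMk hα)) hmem
  simp only at h
  exact h

theorem IsSmoothLoss.measurable_uncurry [MeasurableSpace Ξ] (hs : IsSmoothLoss l G L) (hm : ∀ x, Measurable (l x)) :
    Measurable fun p : Vec d × Ξ => l p.1 p.2 :=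
  measurable_uncurry_of_continuous_of_measurable (fun ξ => (hs.differentiable ξ).continuous) hm

theorem measurable_twoPointEstimate [MeasurableSpace Ξ] (hs : IsSmoothLoss l G L) (hm : ∀ x, Measurable (l x)) {N : ℕ}
    (ν : ℝ) {x : Ω → Vec d} (hx : Measurable x) {ξ : Ω → Fin N → Ξ} {u : Ω → Fin N → Vec d}
    (hξ : ∀ j, Measurable fun ω => ξ ω j) (hu : ∀ j, Measurable fun ω => u ω j) :
    Measurable fun ω => twoPointEstimate l ν (x ω) (ξ ω) (u ω) := by
  have hl := hs.measurable_uncurry hm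
  unfold twoPointEstimate
  have hterm : ∀ j, Measurable fun ω =>
      (l (x ω + ν • u ω j) (ξ ω j) - l (x ω) (ξ ω j)) • u ω j := by
    intro j
    have h1 : Measurable fun ω => ν • u ω j := (hu j).const_smul ν
    have h2 : Measurable fun ω => x ω + ν • u ω j := hx.add h1
    have h3 : Measurable fun ω => l (x ω + ν • u ω j) (ξ ω j) := hl.comp (h2.prodMk (hξ j))
    have h4 : Measurable fun ω => l (x ω) (ξ ω j) := hl.comp (hx.prodMk (hξ j))
    exact (h3.sub h4).smul (hu j)
  have hsum : Measurable fun ω =>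
      ∑ j, (l (x ω + ν • u ω j) (ξ ω j) - l (x ω) (ξ ω j)) • u ω j :=
    Finset.measurable_fun_sum _ fun j _ => hterm j
  exact (measurable_const (a := 1 / ((N : ℝ) * ν))).smul hsum

variable {N : ℕ} {ν : ℝ} {T : ℕ} {x₁ : Vec d} {ξ : ℕ → Fin N → Ω → Ξ} {u : ℕ → Fin N → Ω → Vec d}
  {x g v : ℕ → Ω → Vec d} {lam α : ℕ → Ω → ℝ}

theorem measurable_alpha_of_run
    (hrun : ∀ ω, IsZOAdaExpGradPlusRun K r l ν T x₁ (fun t j => ξ t j ω) (fun t j => u t j ω)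
      (fun t => x t ω) (fun t => g t ω) (fun t => v t ω) (fun t => lam t ω) (fun t => α t ω))
    {t : ℕ} (ht : t ∈ Finset.Icc 1 (T + 1))
    (hA : Measurable fun ω => ∑ s ∈ Finset.Ico 1 t,
      lam s ω ^ 2 * α s ω ^ 2 * l1Norm (v s ω - x s ω) ^ 2) : Measurable (α t) := by
  have h : α t = fun ω => √(max (∑ s ∈ Finset.Ico 1 t,
      lam s ω ^ 2 * α s ω ^ 2 * l1Norm (v s ω - x s ω) ^ 2) 1) :=
    funext fun ω => (hrun ω).alpha_eq t ht
  rw [h]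
  exact (hA.max measurable_const).sqrt

variable [MeasurableSpace Ξ]

/-- The induction step for adaptedness. The running sum inside `α` is carried along with `x`, since
the two determine the rest of the state. The `σ`-algebra on `Ω` is arbitrary, so that `pastSamples`
can be substituted. -/
theorem measurable_succ_of_run (hd : 0 < d) (hKc : IsClosed K) (hK : Convex ℝ K)
    (hr : ConvexOn ℝ Set.univ r) {D : ℝ} (hKD : ∀ x ∈ K, l1Norm x ≤ D)
    (hs : IsSmoothLoss l G L) (hm : ∀ x, Measurable (l x))
    (hrun : ∀ ω, IsZOAdaExpGradPlusRun K r l ν T x₁ (fun t j => ξ t j ω) (fun t j => u t j ω)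
      (fun t => x t ω) (fun t => g t ω) (fun t => v t ω) (fun t => lam t ω) (fun t => α t ω))
    {t : ℕ} (ht : t ∈ Finset.Icc 1 T) (hxK : ∀ ω, x t ω ∈ K)
    (hξ : ∀ j, Measurable (ξ t j)) (hu : ∀ j, Measurable (u t j)) (hx : Measurable (x t))
    (hA : Measurable fun ω => ∑ s ∈ Finset.Ico 1 t,
      lam s ω ^ 2 * α s ω ^ 2 * l1Norm (v s ω - x s ω) ^ 2) :
    Measurable (x (t + 1)) ∧ Measurable fun ω => ∑ s ∈ Finset.Ico 1 (t + 1),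
      lam s ω ^ 2 * α s ω ^ 2 * l1Norm (v s ω - x s ω) ^ 2 := by
  have ht' := Finset.mem_Icc.1 ht
  have htm : t ∈ Finset.Icc 1 (T + 1) := Finset.mem_Icc.2 ⟨ht'.1, by omega⟩
  have htm' : t + 1 ∈ Finset.Icc 1 (T + 1) := Finset.mem_Icc.2 ⟨by omega, by omega⟩
  have hα := measurable_alpha_of_run hrun htm hA
  have hl1 : Measurable (l1Norm : Vec d → ℝ) := continuous_l1Norm.measurable
  have hg : Measurable (g t) := by
    have h : g t = fun ω => twoPointEstimate l ν (x t ω) (fun j => ξ t j ω) (fun j => u t j ω) :=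
      funext fun ω => (hrun ω).estimate t ht
    rw [h]
    exact measurable_twoPointEstimate hs hm ν hx hξ hu
  have hv : Measurable (v t) := by
    have h : v t = fun ω => mirrorProx K r symEntropy (x t ω) (g t ω) (α t ω) :=
      funext fun ω => (hrun ω).mirror_step t ht
    rw [h]
    exact measurable_mirrorProx hd hKc hK hr hKD hx hg hα hxK fun ω =>
      zero_lt_one.trans_le ((hrun ω).one_le_alpha htm)
  have hlam : Measurable (lam t) := by
    have h : lam t = fun ω => 1 / (max (l1Norm (x t ω)) (l1Norm (v t ω)) + 1) :=
      funext fun ω => (hrun ω).lam_eq t ht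
    rw [h]
    exact measurable_const.div (((hl1.comp hx).max (hl1.comp hv)).add_const 1)
  have hA' : Measurable fun ω => ∑ s ∈ Finset.Ico 1 (t + 1),
      lam s ω ^ 2 * α s ω ^ 2 * l1Norm (v s ω - x s ω) ^ 2 := by
    simp only [Finset.sum_Ico_succ_top ht'.1]
    exact hA.add (((hlam.pow_const 2).mul (hα.pow_const 2)).mul
      ((hl1.comp (hv.sub hx)).pow_const 2))
  refine ⟨?_, hA'⟩
  have hα' := measurable_alpha_of_run hrun htm' hA'
  have h : x (t + 1) = fun ω => (1 - α t ω / α (t + 1) ω) • x t ω +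
      (α t ω / α (t + 1) ω) • v t ω := funext fun ω => (hrun ω).update t ht
  rw [h]
  exact ((measurable_const.sub (hα.div hα')).smul hx).add ((hα.div hα').smul hv)

end RunMeasurability

/-! ### Adaptedness of the iterates to the past samples. -/

section RunPastMeasurability

variable {d : ℕ} {Ξ Ω : Type*} [MeasurableSpace Ξ] {K : Set (Vec d)}
  {r : Vec d → ℝ} {l : Vec d → Ξ → ℝ} {G L : ℝ}
  {N : ℕ} {ν : ℝ} {T : ℕ} {x₁ : Vec d} {ξ : ℕ → Fin N → Ω → Ξ} {u : ℕ → Fin N → Ω → Vec d}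
  {x g v : ℕ → Ω → Vec d} {lam α : ℕ → Ω → ℝ}

theorem measurable_pastSamples_of_run (hd : 0 < d) (hKc : IsClosed K) (hK : Convex ℝ K)
    (hr : ConvexOn ℝ Set.univ r) {D : ℝ} (hKD : ∀ x ∈ K, l1Norm x ≤ D)
    (hs : IsSmoothLoss l G L) (hm : ∀ x, Measurable (l x))
    (hrun : ∀ ω, IsZOAdaExpGradPlusRun K r l ν T x₁ (fun t j => ξ t j ω) (fun t j => u t j ω)
      (fun t => x t ω) (fun t => g t ω) (fun t => v t ω) (fun t => lam t ω) (fun t => α t ω))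
    (hxK : ∀ ω, ∀ t ∈ Finset.Icc 1 (T + 1), x t ω ∈ K) {t : ℕ} (ht : t ∈ Finset.Icc 1 (T + 1)) :
    Measurable[pastSamples (fun (p : ℕ × Fin N) ω => (ξ p.1 p.2 ω, u p.1 p.2 ω)) t] (x t) ∧
    Measurable[pastSamples (fun (p : ℕ × Fin N) ω => (ξ p.1 p.2 ω, u p.1 p.2 ω)) t] (α t) := by
  set S : ℕ × Fin N → Ω → Ξ × Vec d := fun p ω => (ξ p.1 p.2 ω, u p.1 p.2 ω) with hS
  have key : ∀ t, 1 ≤ t → t ≤ T + 1 → Measurable[pastSamples S t] (x t) ∧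
      Measurable[pastSamples S t] fun ω => ∑ s ∈ Finset.Ico 1 t,
        lam s ω ^ 2 * α s ω ^ 2 * l1Norm (v s ω - x s ω) ^ 2 := by
    intro t h1
    induction t, h1 using Nat.le_induction with
    | base =>
      intro _
      have h : x 1 = fun _ => x₁ := funext fun ω => (hrun ω).init
      rw [h]
      simp only [Finset.Ico_self, Finset.sum_empty]
      exact ⟨measurable_const, measurable_const⟩
    | succ t h1 ih =>
      intro h2
      obtain ⟨ihx, ihA⟩ := ih (by omega)
      have hle := pastSamples_mono S (Nat.le_succ t)
      have hp : ∀ j, Measurable[pastSamples S (t + 1)] (S (t, j)) := fun j =>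
        measurable_pastSamples S (Nat.lt_succ_self t)
      exact measurable_succ_of_run (mΩ := pastSamples S (t + 1)) hd hKc hK hr hKD hs hm hrun
        (Finset.mem_Icc.2 ⟨h1, by omega⟩)
        (fun ω => hxK ω t (Finset.mem_Icc.2 ⟨h1, by omega⟩))
        (fun j => measurable_fst.comp (hp j)) (fun j => measurable_snd.comp (hp j))
        (ihx.mono hle le_rfl) (ihA.mono hle le_rfl)
  have ht' := Finset.mem_Icc.1 ht
  obtain ⟨hx, hA⟩ := key t ht'.1 ht'.2
  exact ⟨hx, measurable_alpha_of_run (mΩ := pastSamples S t) hrun ht hA⟩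

end RunPastMeasurability

/-! ### Averaging over an independent uniform index. -/

section UniformIndex

variable {Ω : Type*} [MeasurableSpace Ω] {P : Measure Ω}

theorem ae_mem_Icc_of_uniform {T : ℕ} {τ : Ω → ℕ} (hτ : Measurable τ)
    (hlaw : P.map τ = uniformOn (Set.Icc 1 T)) : ∀ᵐ ω ∂P, τ ω ∈ Set.Icc 1 T := by
  have h : ∀ᵐ t ∂(P.map τ), t ∈ Set.Icc 1 T := by
    rw [hlaw]
    exact ae_cond_mem measurableSet_Icc
  exact ae_of_ae_map hτ.aemeasurable h

/-- Evaluation of a finite family at an independent uniform index. -/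
theorem integral_uniform_index {β : Type*} [MeasurableSpace β] {T : ℕ} {τ : Ω → ℕ} (hτ : Measurable τ)
    (hlaw : P.map τ = uniformOn (Set.Icc 1 T)) {S : Ω → β}
    (hind : IndepFun τ S P) {h : ℕ → Ω → ℝ}
    (hm : ∀ t ∈ Finset.Icc 1 T, Measurable[MeasurableSpace.comap S inferInstance] (h t))
    (hi : ∀ t ∈ Finset.Icc 1 T, Integrable (h t) P) :
    Integrable (fun ω => h (τ ω) ω) P ∧
      ∫ ω, h (τ ω) ω ∂P = 1 / (T : ℝ) * ∑ t ∈ Finset.Icc 1 T, ∫ ω, h t ω ∂P := by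
  have hcount : (Measure.count : Measure ℕ) (Set.Icc 1 T) = T := by
    rw [← Finset.coe_Icc, Measure.count_apply_finset]
    simp
  have hmem := ae_mem_Icc_of_uniform hτ hlaw
  have hprob : ∀ t ∈ Finset.Icc 1 T, P.real (τ ⁻¹' {t}) = 1 / (T : ℝ) := by
    intro t ht
    rw [Measure.real, ← Measure.map_apply hτ (measurableSet_singleton t), hlaw, uniformOn,
      cond_apply measurableSet_Icc, hcount,
      Set.inter_eq_self_of_subset_right (by simpa using ht)]
    simp
  -- Splitting over the values of `τ`: each indicator is independent of `h t`, so the expectation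
  -- factors with weight `1 / T`.
  set f : ℕ → Ω → ℝ := fun t ω => (τ ⁻¹' {t}).indicator (fun _ => (1 : ℝ)) ω * h t ω with hf
  have hset : ∀ t, MeasurableSet (τ ⁻¹' {t}) := fun t => hτ (measurableSet_singleton t)
  have hfi : ∀ t ∈ Finset.Icc 1 T, Integrable (f t) P := by
    intro t ht
    have : f t = (τ ⁻¹' {t}).indicator (h t) := by
      funext ω
      by_cases hω : ω ∈ τ ⁻¹' {t}
      · simp only [hf, Set.indicator_of_mem hω, one_mul]
      · simp only [hf, Set.indicator_of_notMem hω, zero_mul]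
    rw [this]
    exact (hi t ht).indicator (hset t)
  have hae : (fun ω => h (τ ω) ω) =ᵐ[P] fun ω => ∑ t ∈ Finset.Icc 1 T, f t ω := by
    filter_upwards [hmem] with ω hω
    rw [Finset.sum_eq_single_of_mem (τ ω) (by simpa using hω)]
    · simp [hf]
    · intro t _ ht
      simp [hf, ht.symm]
  refine ⟨(integrable_finsetSum _ hfi).congr hae.symm, ?_⟩
  rw [integral_congr_ae hae, integral_finsetSum _ hfi, Finset.mul_sum]
  refine Finset.sum_congr rfl fun t ht => ?_
  have hit : IndepFun ((τ ⁻¹' {t}).indicator fun _ => (1 : ℝ)) (h t) P := by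
    rw [IndepFun_iff_Indep] at hind ⊢
    refine indep_of_indep_of_le_left (indep_of_indep_of_le_right hind (hm t ht).comap_le) ?_
    rw [← measurable_iff_comap_le]
    exact measurable_const.indicator ⟨{t}, measurableSet_singleton t, rfl⟩
  have h1 := hit.integral_fun_mul_eq_mul_integral
    (measurable_const.indicator (hset t)).aestronglyMeasurable (hi t ht).aestronglyMeasurable
  rw [hf]
  simp only
  rw [h1, integral_indicator_const _ (hset t), hprob t ht, smul_eq_mul, mul_one]

end UniformIndex

/-! ### The estimation error along the random run, and assembly. -/

section Main

variable {d : ℕ} {Ξ Ω : Type*} [MeasurableSpace Ξ] [MeasurableSpace Ω] {P : Measure Ω}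
  {𝒟 : Measure Ξ} {T N : ℕ} {ξ : ℕ → Fin N → Ω → Ξ}
  {u : ℕ → Fin N → Ω → Vec d} {τ : Ω → ℕ}

theorem IsSampling.ae_abs_eq_one [IsProbabilityMeasure 𝒟] (h : IsSampling P 𝒟 T N ξ u τ) :
    ∀ᵐ ω ∂P, ∀ t j i, |u t j ω i| = 1 := by
  rw [ae_all_iff]
  intro t
  rw [ae_all_iff]
  intro j
  have h1 : ∀ᵐ p ∂𝒟.prod (rademacherVec d), ∀ i, |p.2 i| = 1 :=
    Measure.quasiMeasurePreserving_snd.ae ae_abs_rademacherVec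
  rw [← h.law t j] at h1
  exact ae_of_ae_map ((h.measurable_xi t j).prodMk (h.measurable_u t j)).aemeasurable h1

theorem l1Norm_gradMap (hd : 0 < d) (K : Set (Vec d)) (r : Vec d → ℝ) {c α : ℝ} (hc : 0 < c)
    (hα : 0 ≤ α) (x g : Vec d) :
    l1Norm (gradMap K r (fun y => c * symEntropy y) x g (α / c)) =
      α / c * l1Norm (x - mirrorProx K r symEntropy x g α) := by
  rw [gradMap, mirrorProx_const_mul hd hc.ne', l1Norm_smul, abs_of_nonneg (by positivity)]

variable [IsProbabilityMeasure P] [IsProbabilityMeasure 𝒟]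

/-- The mean square error of the estimate at the random iterate, which is independent of the
current batch. -/
theorem integral_estimate_error_sq_le (hd : 2 ≤ d) {l : Vec d → Ξ → ℝ} {G L : ℝ}
    (hs : IsSmoothLoss l G L) (hl : IsUnbiasedLoss 𝒟 l) (hG : 0 ≤ G) (hL : 0 ≤ L) (hT : 1 ≤ T)
    (hN : 2 * T * Real.exp 1 * (2 * Real.log d - 1) ≤ N) {ν : ℝ} (hν : ν = 1 / (d * √T))
    (h : IsSampling P 𝒟 T N ξ u τ) {t : ℕ} {x : Ω → Vec d}
    (hx : Measurable[pastSamples (fun (p : ℕ × Fin N) ω => (ξ p.1 p.2 ω, u p.1 p.2 ω)) t] x) :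
    Integrable (fun ω => supNorm (twoPointEstimate l ν (x ω) (fun j => ξ t j ω)
      (fun j => u t j ω) - gradient (expLoss 𝒟 l) (x ω)) ^ 2) P ∧
    ∫ ω, supNorm (twoPointEstimate l ν (x ω) (fun j => ξ t j ω) (fun j => u t j ω) -
      gradient (expLoss 𝒟 l) (x ω)) ^ 2 ∂P ≤ (12 * G ^ 2 + L ^ 2 / 2) / T := by
  set S : ℕ × Fin N → Ω → Ξ × Vec d := fun p ω => (ξ p.1 p.2 ω, u p.1 p.2 ω) with hS
  have hd0 : 0 < d := by omega
  have hN0 : 0 < N := by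
    have h1 := two_mul_log_sub_one_pos hd
    have hT0 : (0 : ℝ) < T := by exact_mod_cast hT
    have : (0 : ℝ) < N := lt_of_lt_of_le (by positivity) hN
    exact_mod_cast this
  have hSm : ∀ p, Measurable (S p) := fun p => (h.measurable_xi _ _).prodMk (h.measurable_u _ _)
  have hind : IndepFun x (fun ω j => S (t, j) ω) P := indepFun_batch hSm h.indep hx
  have hxm : Measurable x := hx.mono (iSup₂_le fun p _ => (hSm p).comap_le) le_rfl
  have hgrad : Measurable (gradient (expLoss 𝒟 l)) :=
    (continuous_gradient_expLoss hG hs hl).measurable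
  set F : Vec d → (Fin N → Ξ × Vec d) → ℝ := fun z b =>
    supNorm (twoPointEstimate l ν z (fun j => (b j).1) (fun j => (b j).2) -
      gradient (expLoss 𝒟 l) z) ^ 2 with hF
  have hFm : Measurable fun p : Vec d × (Fin N → Ξ × Vec d) => F p.1 p.2 := by
    have h1 : Measurable fun p : Vec d × (Fin N → Ξ × Vec d) =>
        twoPointEstimate l ν p.1 (fun j => (p.2 j).1) (fun j => (p.2 j).2) :=
      measurable_twoPointEstimate hs hl.measurable ν measurable_fst
        (fun j => measurable_fst.comp ((measurable_pi_apply j).comp measurable_snd))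
        (fun j => measurable_snd.comp ((measurable_pi_apply j).comp measurable_snd))
    have h2 := h1.sub (hgrad.comp measurable_fst)
    exact (continuous_supNorm.measurable.comp h2).pow_const 2
  have hbm : Measurable fun ω j => S (t, j) ω := measurable_pi_lambda _ fun j => hSm (t, j)
  have hint : Integrable (fun ω => F (x ω) (fun j => S (t, j) ω)) P := by
    refine Integrable.of_bound (hFm.comp (hxm.prodMk hbm)).aestronglyMeasurable
      (2 * (G * √d + G) ^ 2 + L ^ 2 / 2) ?_
    filter_upwards [h.ae_abs_eq_one] with ω hω
    rw [Real.norm_of_nonneg (sq_nonneg _)]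
    exact supNorm_twoPointEstimate_sub_sq_le_const hd0 hs hN0 hG hL hT hν _
      (norm_gradient_expLoss_le hG hs hl _) _ _ (hω t)
  refine ⟨hint, ?_⟩
  -- The bound at a fixed point needs independence within the batch, obtained by restricting the
  -- family to indices `(t, j)`.
  have hbatch : iIndepFun (fun j ω => (ξ t j ω, u t j ω)) P :=
    h.indep.precomp (g := fun j : Fin N => (t, j)) fun j k hjk => (Prod.mk.inj hjk).2
  have := integral_comp_le_of_indepFun hxm hbm hind hFm hint
    (b := fun _ => (12 * G ^ 2 + L ^ 2 / 2) / T) (integrable_const _)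
    (Filter.Eventually.of_forall fun ω =>
      integral_supNorm_twoPointEstimate_sub_sq_le hd hs hl hG hL hT hN hν (h.measurable_xi t)
        (h.measurable_u t) (h.law t) hbatch (by filter_upwards [h.ae_abs_eq_one] with ω hω using hω t)
        (x ω))
  simpa using this

end Main
theorem mainTheorem3
    {d : ℕ} (hd : 2 ≤ d)
    {Ξ : Type*} [MeasurableSpace Ξ] (𝒟 : Measure Ξ) [IsProbabilityMeasure 𝒟]
    {Ω : Type*} [MeasurableSpace Ω] (P : Measure Ω) [IsProbabilityMeasure P]
    -- the problem: minimise `f = E_ξ[l(·; ξ)] + r` over `K`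
    (K : Set (Vec d)) (hKclosed : IsClosed K) (hKconvex : Convex ℝ K)
    (r : Vec d → ℝ) (hr : ConvexOn ℝ Set.univ r)
    (l : Vec d → Ξ → ℝ) (G L σ D R : ℝ)
    (hsmooth : IsSmoothLoss l G L)
    (hunbiased : IsUnbiasedLoss 𝒟 l)
    (hvar : ∀ x ∈ K,
      ∫ ξ, ‖gradient (expLoss 𝒟 l) x - gradient (fun z => l z ξ) x‖ ^ 2 ∂𝒟 ≤ σ ^ 2)
    (hDpos : 0 < D)
    (hD : ∀ x ∈ K, ∀ (g : Vec d) (η : ℝ), 0 < η →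
      l1Norm (mirrorProx K r symEntropy x g η) ≤ D)
    (hRpos : 0 < R)
    (hR : ∀ x ∈ K, expLoss 𝒟 l x + r x ∈ Set.Icc 0 R)
    -- the parameters of the algorithm
    (T : ℕ) (hT : 1 ≤ T)
    (m : ℝ) (hm : m = 2 * T * Real.exp 1 * (2 * Real.log d - 1))
    (N : ℕ) (hN : m ≤ N)
    (ν : ℝ) (hν : ν = 1 / (d * √T))
    (x₁ : Vec d) (hx₁ : x₁ ∈ K)
    -- a random run of the algorithm
    (ξ : ℕ → Fin N → Ω → Ξ) (u : ℕ → Fin N → Ω → Vec d) (τ : Ω → ℕ)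
    (hsampling : IsSampling P 𝒟 T N ξ u τ)
    (x g v : ℕ → Ω → Vec d) (lam α : ℕ → Ω → ℝ)
    (hrun : ∀ ω, IsZOAdaExpGradPlusRun K r l ν T x₁
      (fun t j => ξ t j ω) (fun t j => u t j ω)
      (fun t => x t ω) (fun t => g t ω) (fun t => v t ω)
      (fun t => lam t ω) (fun t => α t ω))
    (V C : ℝ) (hV : V = 10 * G ^ 2 + 8 * σ ^ 2 + 2 * L ^ 2)
    (hC : C = 8 * R ^ 2 + 8 * R + 16 * L ^ 2 * (D + 1) ^ 2) :
    Integrable (fun ω => l1Norm (gradMap K r (fun y => (D + 1) * symEntropy y) (x (τ ω) ω)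
      (gradient (expLoss 𝒟 l) (x (τ ω) ω)) (α (τ ω) ω / (D + 1))) ^ 2) P ∧
    ∫ ω, l1Norm (gradMap K r (fun y => (D + 1) * symEntropy y) (x (τ ω) ω)
      (gradient (expLoss 𝒟 l) (x (τ ω) ω)) (α (τ ω) ω / (D + 1))) ^ 2 ∂P
      ≤ √(2 * Real.exp 1 * (2 * Real.log d - 1) / (m * T)) * (10 * V + C) := by

  have hd0 : 0 < d := by omega
  have hT0 : (0 : ℝ) < T := by exact_mod_cast hT
  have hΞ : Nonempty Ξ := nonempty_of_isProbabilityMeasure 𝒟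
  have hG := hsmooth.lipschitzConst_nonneg hd0
  have hL := hsmooth.smoothConst_nonneg hd0
  have hrc := continuous_of_convexOn_univ hr
  -- The objective varies by at most `R` on `K` and the expected loss is `G`-Lipschitz, so `r`
  -- decays at most linearly, as needed before `K` is known to be bounded.
  have hlow : ∀ x ∈ K, ∀ y ∈ K, r x - R - G * l1Norm (y - x) ≤ r y := by
    intro x hx y hy
    have h1 := (abs_le.1 (abs_expLoss_sub_le hsmooth hunbiased y x)).2
    have h2 := mul_le_mul_of_nonneg_left (norm_le_l1Norm (y - x)) hG
    have h3 := (hR x hx).2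
    have h4 := (hR y hy).1
    linarith
  have hKD : ∀ x ∈ K, l1Norm x ≤ D := fun x hx =>
    l1Norm_le_of_mirrorProx_le hd0 hKclosed hrc hRpos.le hG hDpos.le hlow hD hx
  have hprox : ∀ x ∈ K, ∀ (g : Vec d) (η : ℝ), mirrorProx K r symEntropy x g η ∈ K :=
    fun x hx g η => (isMirrorProx_mirrorProx hd0 hKclosed hrc hKD hx g η).1
  have hxK : ∀ ω, ∀ t ∈ Finset.Icc 1 (T + 1), x t ω ∈ K := fun ω t ht =>
    (hrun ω).mem hKconvex hx₁ hprox ht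
  have hIcc : ∀ t ∈ Finset.Icc 1 T, t ∈ Finset.Icc 1 (T + 1) := fun t ht => by
    rw [Finset.mem_Icc] at ht ⊢
    omega
  have hα1 : ∀ ω, ∀ t ∈ Finset.Icc 1 T, 1 ≤ α t ω := fun ω t ht =>
    (hrun ω).one_le_alpha (hIcc t ht)
  set S : ℕ × Fin N → Ω → Ξ × Vec d := fun p ω => (ξ p.1 p.2 ω, u p.1 p.2 ω) with hS
  have hSm : ∀ p, Measurable (S p) := fun p =>
    (hsampling.measurable_xi _ _).prodMk (hsampling.measurable_u _ _)
  have hpast : ∀ t ∈ Finset.Icc 1 T, Measurable[pastSamples S t] (x t) ∧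
      Measurable[pastSamples S t] (α t) := fun t ht =>
    measurable_pastSamples_of_run hd0 hKclosed hKconvex hr hKD hsmooth hunbiased.measurable hrun
      hxK (hIcc t ht)
  -- The squared norm of the gradient map for `(D + 1) * symEntropy`, rewritten with the unscaled
  -- mirror step.
  set H : ℕ → Ω → ℝ := fun t ω => (α t ω / (D + 1) * l1Norm (x t ω -
    mirrorProx K r symEntropy (x t ω) (gradient (expLoss 𝒟 l) (x t ω)) (α t ω))) ^ 2 with hH
  have hHm : ∀ t ∈ Finset.Icc 1 T, Measurable[pastSamples S t] (H t) := by
    intro t ht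
    obtain ⟨hx, hα⟩ := hpast t ht
    have hg : Measurable[pastSamples S t] fun ω => gradient (expLoss 𝒟 l) (x t ω) :=
      (continuous_gradient_expLoss hG hsmooth hunbiased).measurable.comp hx
    have hv := measurable_mirrorProx (mΩ := pastSamples S t) hd0 hKclosed hKconvex hr hKD hx hg hα
      (fun ω => hxK ω t (hIcc t ht)) fun ω => zero_lt_one.trans_le (hα1 ω t ht)
    exact ((hα.div_const (D + 1)).mul (continuous_l1Norm.measurable.comp (hx.sub hv))).pow_const 2
  set E : ℕ → Ω → ℝ := fun t ω => supNorm (g t ω - gradient (expLoss 𝒟 l) (x t ω)) ^ 2 with hE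
  have hEi : ∀ t ∈ Finset.Icc 1 T, Integrable (E t) P ∧
      ∫ ω, E t ω ∂P ≤ (12 * G ^ 2 + L ^ 2 / 2) / T := by
    intro t ht
    have h1 : E t = fun ω => supNorm (twoPointEstimate l ν (x t ω) (fun j => ξ t j ω)
        (fun j => u t j ω) - gradient (expLoss 𝒟 l) (x t ω)) ^ 2 := by
      funext ω
      simp only [hE, (hrun ω).estimate t ht]
    rw [h1]
    exact integral_estimate_error_sq_le hd hsmooth hunbiased hG hL hT (hm ▸ hN) hν hsampling
      (hpast t ht).1
  have hshift : ∀ f : ℕ → ℝ, ∑ t ∈ Finset.range T, f (t + 1) = ∑ t ∈ Finset.Icc 1 T, f t :=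
    fun f => by
      have h1 : Finset.Icc 1 T = Finset.Ico (0 + 1) (T + 1) := by
        ext
        simp
      rw [h1, ← Finset.sum_Ico_add', Finset.range_eq_Ico]
  have hpath : ∀ ω, ∑ t ∈ Finset.Icc 1 T, H t ω ≤
      4 * R + 6 * R ^ 2 + 6 * L ^ 2 * (D + 1) ^ 2 + 8 * ∑ t ∈ Finset.Icc 1 T, E t ω := by
    intro ω
    have h1 := (hrun ω).sum_sq_gradMap_le hd0 hKclosed hKconvex hr hx₁ hDpos.le hKD hRpos.le hL hR
      (expLoss_taylor_le hG hsmooth hunbiased)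
    rw [← hshift fun t => H t ω, ← hshift fun t => E t ω]
    exact h1
  have hsumEi : Integrable (fun ω => 4 * R + 6 * R ^ 2 + 6 * L ^ 2 * (D + 1) ^ 2 +
      8 * ∑ t ∈ Finset.Icc 1 T, E t ω) P :=
    (integrable_const _).add ((integrable_finsetSum _ fun t ht => (hEi t ht).1).const_mul 8)
  have hH0 : ∀ t ω, 0 ≤ H t ω := fun t ω => sq_nonneg _
  have hHi : ∀ t ∈ Finset.Icc 1 T, Integrable (H t) P := by
    intro t ht
    -- The pathwise bound on the sum of the nonnegative `H t` also supplies the integrable majorant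
    -- of each one.
    refine hsumEi.mono' ((hHm t ht).mono (iSup₂_le fun p _ => (hSm p).comap_le)
      le_rfl).aestronglyMeasurable (Filter.Eventually.of_forall fun ω => ?_)
    rw [Real.norm_of_nonneg (hH0 t ω)]
    exact (Finset.single_le_sum (f := fun t => H t ω) (fun t _ => hH0 t ω) ht).trans (hpath ω)
  have hsum : ∑ t ∈ Finset.Icc 1 T, ∫ ω, H t ω ∂P ≤
      4 * R + 6 * R ^ 2 + 6 * L ^ 2 * (D + 1) ^ 2 + 8 * (12 * G ^ 2 + L ^ 2 / 2) := by
    rw [← integral_finsetSum _ hHi]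
    refine (integral_mono (integrable_finsetSum _ hHi) hsumEi hpath).trans ?_
    rw [integral_add (integrable_const _)
      ((integrable_finsetSum _ fun t ht => (hEi t ht).1).const_mul 8), integral_const_mul,
      integral_finsetSum _ fun t ht => (hEi t ht).1]
    have h1 : ∑ t ∈ Finset.Icc 1 T, ∫ ω, E t ω ∂P ≤ 12 * G ^ 2 + L ^ 2 / 2 := by
      refine (Finset.sum_le_sum fun t ht => (hEi t ht).2).trans (le_of_eq ?_)
      simp only [Finset.sum_const, Nat.card_Icc, add_tsub_cancel_right, nsmul_eq_mul]
      field_simp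
    simp only [integral_const, probReal_univ, one_smul]
    linarith
  obtain ⟨hi, hval⟩ := integral_uniform_index hsampling.measurable_tau hsampling.law_tau
    hsampling.indep_tau (h := H)
    (fun t ht => (hHm t ht).mono (pastSamples_le_comap S t) le_rfl) hHi
  have hτ := ae_mem_Icc_of_uniform hsampling.measurable_tau hsampling.law_tau
  have hae : (fun ω => l1Norm (gradMap K r (fun y => (D + 1) * symEntropy y) (x (τ ω) ω)
      (gradient (expLoss 𝒟 l) (x (τ ω) ω)) (α (τ ω) ω / (D + 1))) ^ 2) =ᵐ[P]
      fun ω => H (τ ω) ω := by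
    -- Outside `1, …, T` the sign of `α` may be unknown, so the identity is only claimed where `τ`
    -- takes an admissible value.
    filter_upwards [hτ] with ω hω
    rw [l1Norm_gradMap hd0 K r (by positivity)
      (zero_le_one.trans (hα1 ω (τ ω) (by simpa using hω)))]
  refine ⟨hi.congr hae.symm, ?_⟩
  rw [integral_congr_ae hae, hval]
  have hlog := two_mul_log_sub_one_pos hd
  have hsqrt : √(2 * Real.exp 1 * (2 * Real.log d - 1) / (m * T)) = 1 / (T : ℝ) := by
    have h1 : 2 * Real.exp 1 * (2 * Real.log d - 1) / (m * T) = (1 / (T : ℝ)) ^ 2 := by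
      rw [hm]
      have := Real.exp_pos 1
      field_simp
    rw [h1, Real.sqrt_sq (by positivity)]
  rw [hsqrt]
  -- What remains is a termwise comparison: the error contributes `96 G² + 4 L²`, within the `100 G²
  -- + 20 L²` contained in `10 * V`, and the other terms lie below those of `C`.
  refine mul_le_mul_of_nonneg_left (hsum.trans ?_) (by positivity)
  rw [hV, hC]
  have h1 := sq_nonneg G
  have h2 := sq_nonneg L
  have h3 := sq_nonneg σ
  have h4 : 0 ≤ L ^ 2 * (D + 1) ^ 2 := by positivity
  nlinarith
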